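/- Let $n, d \ge 0$ be integers and let $\lambda = (\lambda_1 \ge \lambda_2 \ge \cdots)$ be a partition of $n$. Let $V_\lambda$ be the irreducible complex representation of the symmetric group $S_n$ indexed by $\lambda$, that is, the Specht module: the span of the polytabloids $e_t = \sum_{\pi \in C_t} \operatorname{sgn}(\pi)\, \pi\{t\}$, for $t$ a Young tableau of shape $\lambda$ with entries $1,\dots,n$, tabloid $\{t\}$ and column stabilizer $C_t$, inside the complex permutation representation on the tabloids of shape $\lambda$. Let $S_n$ act on the space $\mathbb{C}[x_1,\dots,x_n]_d$ of homogeneous polynomials of degree $d$ by permuting the variables. Number the boxes of the Young diagram of $\lambda$ from $1$ to $n$ in any order, let $h_i$ be the hook length of the $i$-th box, and put $n(\lambda) = \sum_{i \ge 1} (i-1)\lambda_i$. Then $V_\lambda$ is irreducible, and its multiplicity in $\mathbb{C}[x_1,\dots,x_n]_d$ (the number of summands isomorphic to $V_\lambda$ in any decomposition into a direct sum of irreducible subrepresentations; such decompositions exist) equals the number of solutions $y \in \mathbb{N}^n$, where $\mathbb{N} = \{0,1,2,\dots\}$, of the equation $$h_1 y_1 + \cdots + h_n y_n = d - n(\lambda).$$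 -/

import Mathlib

namespace SymMult

open Equiv

/-! ### Multiplicities in a direct sum of irreducible representations -/

section Multiplicity

variable {G V W : Type*} [Group G] [AddCommGroup V] [Module ℂ V] [AddCommGroup W] [Module ℂ W]

/-- `V` is the internal direct sum of the irreducible subrepresentations `U 0, …, U (k - 1)`. -/
structure IsIrreducibleDecomposition (ρ : Representation ℂ G V) {k : ℕ}
    (U : Fin k → Subrepresentation ρ) : Prop where
  isInternal : DirectSum.IsInternal fun i => (U i).toSubmodule
  isIrreducible : ∀ i, (U i).toRepresentation.IsIrreducible

/-- The representation `σ` occurs in `ρ` with multiplicity `m`: the representation `ρ` is a finite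
direct sum of irreducible subrepresentations, and in every such decomposition exactly `m` of the
summands are isomorphic to `σ`. -/
def HasMultiplicity (ρ : Representation ℂ G V) (σ : Representation ℂ G W) (m : ℕ) : Prop :=
  (∃ (k : ℕ) (U : Fin k → Subrepresentation ρ), IsIrreducibleDecomposition ρ U) ∧
  ∀ (k : ℕ) (U : Fin k → Subrepresentation ρ), IsIrreducibleDecomposition ρ U →
    Nat.card {i : Fin k // Nonempty ((U i).toRepresentation.Equiv σ)} = m

end Multiplicity

/-! ### The symmetric group acting on homogeneous polynomials -/

/-- `S_n` acting on `ℂ[x_1, …, x_n]` by permuting the variables, `g • x_i = x_{g i}`. -/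
noncomputable def polyRep (n : ℕ) :
    Representation ℂ (Perm (Fin n)) (MvPolynomial (Fin n) ℂ) where
  toFun g := (MvPolynomial.rename g).toLinearMap
  map_one' := by
    refine LinearMap.ext fun p => ?_
    simp
  map_mul' g h := by
    refine LinearMap.ext fun p => ?_
    simp [MvPolynomial.rename_rename]

/-- The homogeneous polynomials of degree `d` (with zero), stable under permuting variables. -/
noncomputable def homogeneousSubrep (n d : ℕ) : Subrepresentation (polyRep n) where
  toSubmodule := MvPolynomial.homogeneousSubmodule (Fin n) ℂ d
  apply_mem_toSubmodule _ _ hp := MvPolynomial.IsHomogeneous.rename_isHomogeneous hp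

/-- `S_n` acting on `ℂ[x_1, …, x_n]_d`. -/
noncomputable def homogeneousRep (n d : ℕ) :
    Representation ℂ (Perm (Fin n)) (homogeneousSubrep n d).toSubmodule :=
  (homogeneousSubrep n d).toRepresentation

/-! ### Hook lengths and `n(λ)` -/

/-- The hook length of the box `c = (i, j)` of `μ` (row `i`, column `j`, counted from `0`):
arm length plus leg length plus one. -/
def hookLength (μ : YoungDiagram) (c : ℕ × ℕ) : ℕ :=
  (μ.rowLen c.1 - c.2 - 1) + (μ.colLen c.2 - c.1 - 1) + 1

/-- `n(λ) = ∑ (i - 1) λ_i`; rows are counted from `0` here. -/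
def nStat (μ : YoungDiagram) : ℕ :=
  ∑ i ∈ Finset.range (μ.colLen 0), i * μ.rowLen i

/-! ### Specht modules -/

/-- A Young tableau of shape `μ` with entries `Fin n`, each used once: `t i` is the box that
contains `i`. -/
abbrev Tableau (μ : YoungDiagram) (n : ℕ) : Type := Fin n ≃ μ.cells

/-- A tabloid of shape `μ` (a tableau up to permutations within the rows), given by the
function sending each entry to its row. -/
def Tabloid (μ : YoungDiagram) (n : ℕ) : Type :=
  {f : Fin n → ℕ // ∀ r, Nat.card {i // f i = r} = μ.rowLen r}

/-- `S_n` acts on tabloids by permuting the entries. -/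
instance (μ : YoungDiagram) (n : ℕ) : MulAction (Perm (Fin n)) (Tabloid μ n) where
  smul g T := ⟨fun i => T.1 (g⁻¹ i), fun r => by
    rw [← T.2 r]
    exact Nat.card_congr ((g⁻¹ : Perm (Fin n)).subtypeEquiv fun _ => Iff.rfl)⟩
  one_smul _ := rfl
  mul_smul g h T := Subtype.ext <| funext fun i => by
    change T.1 ((g * h)⁻¹ i) = T.1 (h⁻¹ (g⁻¹ i))
    rw [mul_inv_rev, Perm.mul_apply]

/-- The tabloid `{t}` of a tableau `t`. -/
def Tableau.tabloid {μ : YoungDiagram} {n : ℕ} (t : Tableau μ n) : Tabloid μ n :=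
  ⟨fun i => (t i).1.1, fun r => by
    rw [YoungDiagram.rowLen_eq_card, ← Nat.card_eq_finsetCard]
    refine Nat.card_congr ((t.subtypeEquiv (q := fun c => c.1.1 = r) fun _ => Iff.rfl).trans
      ⟨fun c => ⟨c.1.1, YoungDiagram.mem_row_iff.2 ⟨c.1.2, c.2⟩⟩,
        fun c => ⟨⟨c.1, (YoungDiagram.mem_row_iff.1 c.2).1⟩, (YoungDiagram.mem_row_iff.1 c.2).2⟩,
        fun _ => rfl, fun _ => rfl⟩)⟩

/-- The column stabilizer of `t`: the permutations that keep every entry in its column of `t`. -/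
def Tableau.colStabilizer {μ : YoungDiagram} {n : ℕ} (t : Tableau μ n) :
    Finset (Perm (Fin n)) :=
  Finset.univ.filter fun π => ∀ i, (t (π i)).1.2 = (t i).1.2

/-- The polytabloid `e_t = ∑ sgn(π) π{t}`, the sum over the column stabilizer of `t`, in the
complex vector space with basis the tabloids. -/
noncomputable def Tableau.polytabloid {μ : YoungDiagram} {n : ℕ} (t : Tableau μ n) :
    MonoidAlgebra ℂ (Tabloid μ n) :=
  ∑ π ∈ t.colStabilizer, MonoidAlgebra.single (π • t.tabloid) ((Perm.sign π : ℤ) : ℂ)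

/-- Permuting the entries of a tableau permutes polytabloids: `g e_t = e_{gt}`. -/
theorem ofMulAction_polytabloid {μ : YoungDiagram} {n : ℕ} (g : Perm (Fin n))
    (t : Tableau μ n) :
    Representation.ofMulAction ℂ (Perm (Fin n)) (Tabloid μ n) g t.polytabloid =
      Tableau.polytabloid ((g⁻¹ : Perm (Fin n)).trans t : Tableau μ n) := by
  unfold Tableau.polytabloid
  rw [map_sum]
  refine Finset.sum_bij' (fun π _ => g * π * g⁻¹) (fun π _ => g⁻¹ * π * g) ?_ ?_ ?_ ?_ ?_
  · intro π hπ
    simp only [Tableau.colStabilizer, Finset.mem_filter, Finset.mem_univ, true_and] at hπ ⊢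
    intro i
    simpa using hπ (g⁻¹ i)
  · intro π hπ
    simp only [Tableau.colStabilizer, Finset.mem_filter, Finset.mem_univ, true_and] at hπ ⊢
    intro i
    simpa using hπ (g i)
  · intro π _
    group
  · intro π _
    group
  · intro π _
    have h : Tableau.tabloid ((g⁻¹ : Perm (Fin n)).trans t : Tableau μ n) = g • t.tabloid := rfl
    rw [h, Representation.ofMulAction_single, smul_smul, smul_smul]
    congr 1
    · congr 1
      group
    · rw [Perm.sign_mul, Perm.sign_mul, Perm.sign_inv, mul_right_comm, Int.units_mul_self, one_mul]

/-- The subrepresentation spanned by the polytabloids of shape `μ` inside the permutation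
representation of `S_n` on tabloids. -/
noncomputable def spechtSubrep (μ : YoungDiagram) (n : ℕ) :
    Subrepresentation (Representation.ofMulAction ℂ (Perm (Fin n)) (Tabloid μ n)) where
  toSubmodule := Submodule.span ℂ (Set.range Tableau.polytabloid)
  apply_mem_toSubmodule g v hv := by
    induction hv using Submodule.span_induction with
    | mem x hx =>
      obtain ⟨t, rfl⟩ := hx
      rw [ofMulAction_polytabloid]
      exact Submodule.subset_span ⟨_, rfl⟩
    | zero => rw [map_zero]; exact Submodule.zero_mem _
    | add x y _ _ hx hy => rw [map_add]; exact Submodule.add_mem _ hx hy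
    | smul a x _ hx => rw [map_smul]; exact Submodule.smul_mem _ a hx

/-- The Specht module `V_λ`, for `μ` the Young diagram of a partition `λ` of `n`. -/
noncomputable def spechtRep (μ : YoungDiagram) (n : ℕ) :
    Representation ℂ (Perm (Fin n)) (spechtSubrep μ n).toSubmodule :=
  (spechtSubrep μ n).toRepresentation

end SymMult


/-!
The multiplicity of `V_λ` in `ℂ[x_1, …, x_n]_d` is the inner product of the two characters. The
character of `V_λ` is given by Frobenius' formula: `χ_λ(g)` is the coefficient of `x ^ (λ + δ)` in
`a_δ p_g`, with `a_l = det (x_i ^ l_j)` and `p_g` the product of the power sums given by the cycle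
type of `g`. Indeed, by Cauchy's identity these coefficients form a class function `φ` of norm one,
and expanding `a_δ` over the permutations `w` of the variables writes `φ` as a signed sum of
permutation characters on words; the column antisymmetrizer of a tableau of shape `λ` kills the
words belonging to every `w ≠ 1`, and those belonging to `w = 1` are the tabloids, in which `V_λ`
occurs once. Hence `⟨φ, χ_λ⟩ = 1`, which forces `φ = χ_λ`.

The degree-`d` character of the polynomial ring is the coefficient of `q ^ d` in `p_g` at
`x = (1, q, q², …)`. By Cauchy's identity again, the multiplicities have generating function
`a_{λ + δ} / a_δ` at that point; both alternants are Vandermonde determinants there, and the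
quotient is `q ^ n(λ) / ∏ (1 - q ^ h)` over the hook lengths `h`, up to factors `1 - q ^ s` with `s`
large. -/

namespace SymMult

open Equiv

section Multiplicity

/-- Subrepresentations of a subrepresentation `U` are the subrepresentations contained in `U`. -/
def subrepresentationOrderIsoIic {k G V : Type*} [CommSemiring k] [Monoid G] [AddCommMonoid V]
    [Module k V] {ρ : Representation k G V} (U : Subrepresentation ρ) :
    Subrepresentation U.toRepresentation ≃o Set.Iic U where
  toFun T :=
    ⟨{ toSubmodule := T.toSubmodule.map U.toSubmodule.subtype
       apply_mem_toSubmodule := by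
        rintro g _ ⟨v, hv, rfl⟩
        exact ⟨_, T.apply_mem_toSubmodule g hv, rfl⟩ },
      Submodule.map_subtype_le U.toSubmodule T.toSubmodule⟩
  invFun T :=
    { toSubmodule := T.1.toSubmodule.comap U.toSubmodule.subtype
      apply_mem_toSubmodule g _ hv := T.1.apply_mem_toSubmodule g hv }
  left_inv T := Subrepresentation.toSubmodule_injective <|
    Submodule.comap_map_eq_of_injective U.toSubmodule.injective_subtype T.toSubmodule
  right_inv T := Subtype.ext <| Subrepresentation.toSubmodule_injective <|
    (Submodule.map_comap_subtype _ _).trans (inf_eq_right.2 T.2)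
  map_rel_iff' := Submodule.map_le_map_iff_of_injective U.toSubmodule.injective_subtype _ _

theorem isIrreducible_toRepresentation_iff_isAtom {k G V : Type*} [Field k] [Monoid G]
    [AddCommGroup V] [Module k V] {ρ : Representation k G V} {U : Subrepresentation ρ} :
    U.toRepresentation.IsIrreducible ↔ IsAtom U :=
  (subrepresentationOrderIsoIic U).isSimpleOrder_iff.trans Set.isSimpleOrder_Iic_iff_isAtom

theorem character_eq_sum_of_isInternal {k G V ι : Type*} [Field k] [Monoid G] [AddCommGroup V]
    [Module k V] [FiniteDimensional k V] [Fintype ι] [DecidableEq ι] {ρ : Representation k G V}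
    {U : ι → Subrepresentation ρ} (hU : DirectSum.IsInternal fun i => (U i).toSubmodule) (g : G) :
    ρ.character g = ∑ i, (U i).toRepresentation.character g :=
  LinearMap.trace_eq_sum_trace_restrict hU fun i _ hv => (U i).apply_mem_toSubmodule g hv

theorem trace_eq_sum_finrank_eigenspace_mul {k V : Type*} [Field k] [AddCommGroup V] [Module k V]
    [FiniteDimensional k V] {f g : Module.End k V} {φ : k → k}
    (htop : ⨆ c, f.eigenspace c = ⊤) (hfin : {c | f.eigenspace c ≠ ⊥}.Finite)
    (hg : ∀ c, ∀ v ∈ f.eigenspace c, g v = φ c • v) :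
    LinearMap.trace k V g = ∑ c ∈ hfin.toFinset, Module.finrank k (f.eigenspace c) * φ c := by
  classical
  have hinternal : DirectSum.IsInternal f.eigenspace :=
    DirectSum.isInternal_submodule_of_iSupIndep_of_iSup_eq_top f.eigenspaces_iSupIndep htop
  have hmaps (c : k) : Set.MapsTo g (f.eigenspace c) (f.eigenspace c) := fun v hv => by
    rw [hg c v hv]
    exact Submodule.smul_mem _ _ hv
  rw [LinearMap.trace_eq_sum_trace_restrict' hinternal hfin hmaps]
  refine Finset.sum_congr rfl fun c _ => ?_
  have hscalar : g.restrict (hmaps c) = φ c • LinearMap.id := LinearMap.ext fun v =>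
    Subtype.ext (hg c v v.2)
  rw [hscalar, map_smul, LinearMap.trace_id, smul_eq_mul, mul_comm]

theorem pow_eq_one_of_hasEigenvalue {k V : Type*} [Field k] [AddCommGroup V] [Module k V]
    {f : Module.End k V} {m : ℕ} (hf : f ^ m = 1) {c : k} (hc : f.HasEigenvalue c) :
    c ^ m = 1 := by
  obtain ⟨v, hv⟩ := hc.exists_hasEigenvector
  have h := hv.pow_apply m
  rw [hf, Module.End.one_apply] at h
  exact smul_left_injective k hv.2 (h.symm.trans (one_smul k v).symm)

theorem iSup_eigenspace_eq_top_of_pow_eq_one {k V : Type*} [Field k] [IsAlgClosed k] [CharZero k]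
    [AddCommGroup V] [Module k V] [FiniteDimensional k V] {f : Module.End k V} {m : ℕ}
    (hm : m ≠ 0) (hf : f ^ m = 1) : ⨆ c, f.eigenspace c = ⊤ := by
  refine (Module.End.isSemisimple_of_squarefree_aeval_eq_zero
    (p := Polynomial.X ^ m - Polynomial.C 1) ?_ (by simp [hf])).iSup_eigenspace_eq_top
  exact (Polynomial.separable_X_pow_sub_C 1 (Nat.cast_ne_zero.2 hm) one_ne_zero).squarefree

variable {G V W : Type*} [Group G] [AddCommGroup V] [Module ℂ V] [AddCommGroup W] [Module ℂ W]

theorem character_inv_eq_conj [Finite G] [FiniteDimensional ℂ V] (ρ : Representation ℂ G V)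
    (g : G) : ρ.character g⁻¹ = starRingEnd ℂ (ρ.character g) := by
  have horder : orderOf g ≠ 0 := (orderOf_pos g).ne'
  have hpow : ρ g ^ orderOf g = 1 := by rw [← map_pow, pow_orderOf_eq_one, map_one]
  have htop := iSup_eigenspace_eq_top_of_pow_eq_one horder hpow
  have hfin : {c | Module.End.eigenspace (ρ g) c ≠ ⊥}.Finite :=
    WellFoundedGT.finite_ne_bot_of_iSupIndep (Module.End.eigenspaces_iSupIndep _)
  have hinv (c : ℂ) (v : V) (hv : v ∈ Module.End.eigenspace (ρ g) c) :
      ρ g⁻¹ v = starRingEnd ℂ c • v := by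
    rcases eq_or_ne v 0 with rfl | hv0
    · simp only [map_zero, smul_zero]
    have hc : c ^ orderOf g = 1 := pow_eq_one_of_hasEigenvalue hpow <|
      Module.End.hasEigenvalue_of_hasEigenvector ⟨hv, hv0⟩
    rw [← Complex.inv_eq_conj (Complex.norm_eq_one_of_pow_eq_one hc horder),
      eq_inv_smul_iff₀ (ne_zero_pow horder (hc ▸ one_ne_zero)), ← map_smul,
      ← Module.End.mem_eigenspace_iff.1 hv, Representation.inv_self_apply]
  simp only [Representation.character, map_sum, map_mul, map_natCast,
    trace_eq_sum_finrank_eigenspace_mul htop hfin hinv,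
    trace_eq_sum_finrank_eigenspace_mul htop hfin (φ := id) fun _ _ hv =>
      Module.End.mem_eigenspace_iff.1 hv, id]

theorem exists_isIrreducibleDecomposition [Finite G] [FiniteDimensional ℂ V]
    (ρ : Representation ℂ G V) :
    ∃ (k : ℕ) (U : Fin k → Subrepresentation ρ), IsIrreducibleDecomposition ρ U := by
  have : NeZero (Nat.card G : ℂ) := ⟨Nat.cast_ne_zero.2 Nat.card_pos.ne'⟩
  obtain ⟨s, hs, htop, hsimple⟩ :=
    IsSemisimpleModule.exists_sSupIndep_sSup_simples_eq_top (MonoidAlgebra ℂ G) ρ.asModule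
  have : FiniteDimensional ℂ ρ.asModule := inferInstanceAs (FiniteDimensional ℂ V)
  have : IsNoetherian (MonoidAlgebra ℂ G) ρ.asModule := isNoetherian_of_tower ℂ inferInstance
  have := (WellFoundedGT.finite_of_sSupIndep hs).to_subtype
  obtain ⟨k, ⟨e⟩⟩ := Finite.exists_equiv_fin s
  have hinternal : DirectSum.IsInternal fun i => (e.symm i).1 := by
    refine DirectSum.isInternal_submodule_of_iSupIndep_of_iSup_eq_top
      (((sSupIndep_iff s).1 hs).comp e.symm.injective) ?_
    rw [← htop, sSup_eq_iSup']
    exact e.symm.iSup_comp (g := fun a : s => a.1)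
  refine ⟨k, fun i => Subrepresentation.ofSubmodule' (e.symm i).1, hinternal, fun i => ?_⟩
  exact isIrreducible_toRepresentation_iff_isAtom.2 <|
    (Subrepresentation.subrepresentationSubmoduleOrderIso.symm.isAtom_iff _).2 <|
      isSimpleModule_iff_isAtom.1 (hsimple _ (e.symm i).2)

theorem sum_character_mul_character_inv [Fintype G] [FiniteDimensional ℂ V]
    [FiniteDimensional ℂ W] (ρ : Representation ℂ G V) (σ : Representation ℂ G W)
    [ρ.IsIrreducible] [σ.IsIrreducible] [Decidable (Nonempty (ρ.Equiv σ))] :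
    ∑ g, ρ.character g * σ.character g⁻¹ =
      Nat.card G * if Nonempty (ρ.Equiv σ) then 1 else 0 := by
  have hG : (Nat.card G : ℂ) ≠ 0 := Nat.cast_ne_zero.2 Nat.card_pos.ne'
  have := invertibleOfNonzero hG
  have hequiv : Nonempty (σ.Equiv ρ) ↔ Nonempty (ρ.Equiv σ) :=
    ⟨fun ⟨e⟩ => ⟨e.symm⟩, fun ⟨e⟩ => ⟨e.symm⟩⟩
  rw [← inv_mul_eq_iff_eq_mul₀ hG, Representation.char_orthonormal]
  simp only [hequiv]

theorem hasMultiplicity_of_sum_character_mul [Fintype G] [FiniteDimensional ℂ V]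
    [FiniteDimensional ℂ W] {ρ : Representation ℂ G V} {σ : Representation ℂ G W}
    [σ.IsIrreducible] {m : ℕ} (h : ∑ g, ρ.character g * σ.character g⁻¹ = Nat.card G * m) :
    HasMultiplicity ρ σ m := by
  classical
  refine ⟨exists_isIrreducibleDecomposition ρ, fun k U hU => ?_⟩
  have hirr := hU.isIrreducible
  have hG : (Nat.card G : ℂ) ≠ 0 := Nat.cast_ne_zero.2 Nat.card_pos.ne'
  simp only [character_eq_sum_of_isInternal hU.isInternal, Finset.sum_mul] at h
  simp only [Finset.sum_comm (s := Finset.univ (α := G)), sum_character_mul_character_inv,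
    ← Finset.mul_sum, Finset.sum_boole] at h
  rw [Nat.card_eq_fintype_card, Fintype.card_subtype]
  exact_mod_cast mul_left_cancel₀ hG h

end Multiplicity

section PermutationRepresentations

theorem trace_eq_card_fixed {k V X : Type*} [CommRing k] [AddCommGroup V] [Module k V] [Finite X]
    (b : Module.Basis X k V) {f : V →ₗ[k] V} {p : X → X} (hf : ∀ x, f (b x) = b (p x)) :
    LinearMap.trace k V f = Nat.card {x // p x = x} := by
  classical
  have := Fintype.ofFinite X
  rw [LinearMap.trace_eq_matrix_trace k b, Matrix.trace, Nat.card_eq_fintype_card,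
    Fintype.card_subtype, ← Finset.sum_boole]
  refine Finset.sum_congr rfl fun x _ => ?_
  rw [Matrix.diag_apply, LinearMap.toMatrix_apply, hf, b.repr_self, Finsupp.single_apply]

instance finite_monoidAlgebra {k X : Type*} [Semiring k] [Finite X] :
    Module.Finite k (MonoidAlgebra k X) :=
  Module.Finite.equiv (MonoidAlgebra.coeffLinearEquiv k).symm

theorem character_ofMulAction {k G X : Type*} [Field k] [Group G] [MulAction G X] [Finite X]
    (g : G) :
    (Representation.ofMulAction k G X).character g = Nat.card {x : X // g • x = x} :=
  trace_eq_card_fixed ⟨MonoidAlgebra.coeffLinearEquiv k⟩ fun x =>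
    Representation.ofMulAction_single g x 1

instance finiteDimensional_homogeneousSubrep (n d : ℕ) :
    FiniteDimensional ℂ (homogeneousSubrep n d).toSubmodule :=
  Module.Finite.iff_fg.2 (MvPolynomial.homogeneousSubmodule_fg _ _ d)

/-- The monomials of degree `d` as a basis of the homogeneous polynomials of degree `d`. -/
noncomputable def homogeneousBasis (n d : ℕ) :
    Module.Basis {a : Fin n →₀ ℕ | a.degree = d} ℂ (homogeneousSubrep n d).toSubmodule :=
  (MvPolynomial.basisRestrictSupport ℂ {a : Fin n →₀ ℕ | a.degree = d}).map
    (LinearEquiv.ofEq _ _ (MvPolynomial.homogeneousSubmodule_eq_finsupp_supported _ _ d).symm)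

theorem coe_homogeneousBasis {n d : ℕ} (a : {a : Fin n →₀ ℕ | a.degree = d}) :
    (homogeneousBasis n d a : MvPolynomial (Fin n) ℂ) = MvPolynomial.monomial a.1 1 :=
  congrArg AddMonoidAlgebra.ofCoeff (Finsupp.supportedEquivFinsupp_symm_single _ a 1)

theorem mapDomain_eq_self_iff {ι M : Type*} [AddCommMonoid M] (g : Perm ι) (a : ι →₀ M) :
    a.mapDomain g = a ↔ ⇑a ∘ g = a := by
  rw [DFunLike.ext_iff, funext_iff, ← g.forall_congr_right]
  simp only [Finsupp.mapDomain_apply g.injective, Function.comp_apply, eq_comm]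

theorem character_homogeneousRep (n d : ℕ) (g : Perm (Fin n)) :
    (homogeneousRep n d).character g = Nat.card {a : Fin n → ℕ // ∑ i, a i = d ∧ a ∘ g = a} := by
  have := Module.Finite.finite_basis (homogeneousBasis n d)
  have htrace := trace_eq_card_fixed (homogeneousBasis n d) (f := homogeneousRep n d g)
    (p := fun a => ⟨a.1.mapDomain g, (Finsupp.degree_mapDomain _ _).trans a.2⟩) fun a => by
      refine Subtype.ext ?_
      rw [coe_homogeneousBasis]
      exact (congrArg _ (coe_homogeneousBasis a)).trans (MvPolynomial.rename_monomial _ _ _)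
  refine htrace.trans (congrArg _ (Nat.card_congr ?_))
  refine (Equiv.subtypeEquivRight fun a => ?_).trans <|
    (Equiv.subtypeSubtypeEquivSubtypeInter (fun a : Fin n →₀ ℕ => a.degree = d)
      fun a => ⇑a ∘ g = a).trans (Finsupp.equivFunOnFinite.subtypeEquiv fun a => ?_)
  · rw [Subtype.ext_iff, mapDomain_eq_self_iff]
  · rw [Finsupp.degree_eq_sum]
    rfl

end PermutationRepresentations

section Words

variable {ι σ τ R : Type*} [Fintype ι] [Fintype σ] [Fintype τ] [CommSemiring R]

theorem prod_X_pow_eq_monomial (c : σ →₀ ℕ) :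
    ∏ a, (MvPolynomial.X a : MvPolynomial σ R) ^ c a = MvPolynomial.monomial c 1 := by
  rw [MvPolynomial.monomial_eq, map_one, one_mul, Finsupp.prod_fintype _ _ fun _ => pow_zero _]

variable [DecidableEq σ] [DecidableEq τ]

/-- The content of a word `f` in the alphabet `σ`: the number of occurrences of each letter. -/
noncomputable def content (f : ι → σ) : σ →₀ ℕ :=
  Finsupp.equivFunOnFinite.symm fun a => Fintype.card {i // f i = a}

theorem content_apply (f : ι → σ) (a : σ) : content f a = Fintype.card {i // f i = a} := rfl

theorem content_comp_perm (f : ι → σ) (g : Perm ι) : content (f ∘ g) = content f :=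
  Finsupp.ext fun _ => Fintype.card_congr (g.subtypeEquiv fun _ => Iff.rfl)

theorem prod_apply_eq_prod_pow_content (f : ι → σ) (z : σ → R) :
    ∏ i, z (f i) = ∏ a, z a ^ content f a := by
  rw [← Finset.prod_fiberwise' Finset.univ f z]
  refine Finset.prod_congr rfl fun a _ => ?_
  rw [Finset.prod_const, content_apply, Fintype.card_subtype]

theorem sum_content (f : ι → σ) : ∑ a, content f a = Fintype.card ι := by
  simp only [content_apply, Fintype.card_subtype]
  exact (Finset.card_eq_sum_card_fiberwise fun _ _ => Finset.mem_univ _).symm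

theorem monomial_content (f : ι → σ) :
    MvPolynomial.monomial (content f) (1 : R) = ∏ i, MvPolynomial.X (f i) := by
  rw [prod_apply_eq_prod_pow_content f MvPolynomial.X, prod_X_pow_eq_monomial]

theorem card_filter_content_eq [DecidableEq ι] {c : σ →₀ ℕ} (hc : ∑ a, c a = Fintype.card ι) :
    (Finset.univ.filter fun f : ι → σ => content f = c).card = Nat.multinomial Finset.univ c := by
  have hexpand : (∑ a, MvPolynomial.X a : MvPolynomial σ ℕ) ^ Fintype.card ι =
      ∑ f : ι → σ, MvPolynomial.monomial (content f) 1 := by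
    simp only [monomial_content]
    rw [← Finset.card_univ, ← Finset.prod_const, Finset.prod_univ_sum, Fintype.piFinset_univ]
  have hcoeff := congrArg (MvPolynomial.coeff c) hexpand
  rw [MvPolynomial.coeff_sum_X_pow_of_fintype, if_pos (by rwa [Finsupp.sum_fintype _ _ (by simp)]),
    Finsupp.multinomial_eq_of_support_subset (Finset.subset_univ _),
    MvPolynomial.coeff_sum] at hcoeff
  simp only [MvPolynomial.coeff_monomial, Finset.sum_boole, Nat.cast_id] at hcoeff
  exact hcoeff.symm

variable [DecidableEq ι]

/-- The sum of the monomials `∏ z (f i)` of the words `f` fixed by the permutation `g`. Such a word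
is constant on the cycles of `g`, so this is the product of the power sums `p_r(z)` over the cycle
lengths `r` of `g`. -/
def fixedWordSum (g : Perm ι) (z : σ → R) : R :=
  ∑ f : ι → σ with f ∘ g = f, ∏ i, z (f i)

/-- The complete homogeneous symmetric polynomial of degree `n` in the variables `z a`. -/
def completeSum (n : ℕ) (z : σ → R) : R :=
  ∑ c ∈ Finset.univ.finsuppAntidiag n, ∏ a, z a ^ c a

theorem map_fixedWordSum {S F : Type*} [CommSemiring S] [FunLike F R S] [RingHomClass F R S]
    (φ : F) (g : Perm ι) (z : σ → R) :
    φ (fixedWordSum g z) = fixedWordSum g (φ ∘ z) := by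
  simp only [fixedWordSum, map_sum, map_prod, Function.comp_apply]

theorem card_comp_perm_eq_self (f : ι → σ) :
    (Finset.univ.filter fun g : Perm ι => f ∘ g = f).card = ∏ a, (content f a).factorial := by
  rw [← Fintype.card_subtype, DomMulAct.stabilizer_card]
  rfl

theorem sum_fixedWordSum (z : σ → R) :
    ∑ g : Perm ι, fixedWordSum g z =
      (Fintype.card ι).factorial * completeSum (Fintype.card ι) z := by
  calc ∑ g : Perm ι, fixedWordSum g z
      = ∑ f : ι → σ, (∏ a, (content f a).factorial : ℕ) * ∏ a, z a ^ content f a := by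
        simp only [fixedWordSum, Finset.sum_filter]
        rw [Finset.sum_comm]
        refine Finset.sum_congr rfl fun f _ => ?_
        rw [← Finset.sum_filter, Finset.sum_const, card_comp_perm_eq_self, nsmul_eq_mul,
          prod_apply_eq_prod_pow_content f z]
    _ = ∑ c ∈ Finset.univ.finsuppAntidiag (Fintype.card ι), ∑ f : ι → σ with content f = c,
          ((∏ a, (c a).factorial : ℕ) * ∏ a, z a ^ c a : R) := by
        rw [← Finset.sum_fiberwise_of_maps_to (g := content) fun f _ =>
          Finset.mem_finsuppAntidiag.2 ⟨sum_content f, Finset.subset_univ _⟩]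
        refine Finset.sum_congr rfl fun c _ => Finset.sum_congr rfl fun f hf => ?_
        rw [(Finset.mem_filter.1 hf).2]
    _ = (Fintype.card ι).factorial * completeSum (Fintype.card ι) z := by
        rw [completeSum, Finset.mul_sum]
        refine Finset.sum_congr rfl fun c hc => ?_
        have hsum := (Finset.mem_finsuppAntidiag.1 hc).1
        rw [Finset.sum_const, card_filter_content_eq hsum, nsmul_eq_mul, ← mul_assoc,
          ← Nat.cast_mul, mul_comm (Nat.multinomial _ _), Nat.multinomial_spec, hsum]

theorem fixedWordSum_mul (g : Perm ι) (x : σ → R) (y : τ → R) :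
    fixedWordSum g x * fixedWordSum g y = fixedWordSum g fun p : σ × τ => x p.1 * y p.2 := by
  simp only [fixedWordSum]
  rw [Finset.sum_mul_sum, ← Finset.sum_product']
  refine Finset.sum_equiv (Equiv.arrowProdEquivProdArrow ι (fun _ => σ) fun _ => τ).symm ?_ ?_
  · simp only [Finset.mem_product, Finset.mem_filter, Finset.mem_univ, true_and, funext_iff,
      Function.comp_apply, Prod.ext_iff, forall_and,
      Equiv.arrowProdEquivProdArrow_symm_apply, implies_true]
  · exact fun p _ => Finset.prod_mul_distrib.symm

end Words

section Cauchy

variable {R : Type*} [CommRing R] {N : ℕ}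

/-- The alternant `det (y_j ^ e_i)`. -/
def alternant (y : Fin N → R) (e : Fin N → ℕ) : R :=
  Matrix.det (Matrix.of fun i j => y j ^ e i)

/-- The exponents `δ = (N - 1, …, 1, 0)`. -/
def staircase (N : ℕ) (i : Fin N) : ℕ := (Fin.rev i : ℕ)

theorem alternant_eq_sum_perm_exponents (y : Fin N → R) (e : Fin N → ℕ) :
    alternant y e = ∑ w : Perm (Fin N), ((Perm.sign w : ℤ) : R) * ∏ i, y i ^ e (w i) := by
  rw [alternant, Matrix.det_apply']
  rfl

theorem alternant_eq_sum_perm_variables (y : Fin N → R) (e : Fin N → ℕ) :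
    alternant y e = ∑ w : Perm (Fin N), ((Perm.sign w : ℤ) : R) * ∏ i, y (w i) ^ e i := by
  rw [alternant, ← Matrix.det_transpose, Matrix.det_apply']
  rfl

theorem map_alternant {S : Type*} [CommRing S] (φ : R →+* S) (y : Fin N → R) (e : Fin N → ℕ) :
    φ (alternant y e) = alternant (φ ∘ y) e := by
  simp only [alternant_eq_sum_perm_exponents, map_sum, map_mul, map_intCast, map_prod, map_pow,
    Function.comp_apply]

theorem alternant_mul (a : R) (y : Fin N → R) (e : Fin N → ℕ) :
    alternant (fun i => y i * a) e = a ^ (∑ i, e i) * alternant y e := by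
  simp only [alternant_eq_sum_perm_exponents, Finset.mul_sum, mul_pow, Finset.prod_mul_distrib]
  refine Finset.sum_congr rfl fun w _ => ?_
  rw [Finset.prod_pow_eq_pow_sum, Equiv.sum_comp w e]
  ring

theorem alternant_staircase (y : Fin N → R) :
    alternant y (staircase N) = ∏ i, ∏ j ∈ Finset.Ioi i, (y i - y j) := by
  have h := Matrix.det_projVandermonde (fun _ => 1) y
  simp only [one_mul] at h
  rw [alternant, ← Matrix.det_transpose, ← h]
  congr 1
  ext i j
  simp [Matrix.projVandermonde_apply, staircase]

theorem alternant_staircase_ne_zero [IsDomain R] {y : Fin N → R} (hy : Function.Injective y) :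
    alternant y (staircase N) ≠ 0 := by
  rw [alternant_staircase]
  exact Finset.prod_ne_zero_iff.2 fun i _ => Finset.prod_ne_zero_iff.2 fun j hj =>
    sub_ne_zero.2 (hy.ne (Finset.mem_Ioi.1 hj).ne)

/-- The matrix whose `(k, j)` entry is the coefficient of `a ^ k * b ^ (N - 1 - k)` in
`∏_{m ≠ j} (a - b y_m)`. It links the Cauchy matrix to the Vandermonde matrices of both sets of
variables. -/
def eraseMatrix (y : Fin N → R) : Matrix (Fin N) (Fin N) R :=
  Matrix.of fun k j =>
    ∑ t ∈ (Finset.univ.erase j).powersetCard k, ∏ m ∈ Finset.univ.erase j \ t, -y m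

theorem prod_add_mul_eq_sum_range {ι : Type*} [DecidableEq ι] (s : Finset ι) (a b : R)
    (c : ι → R) :
    ∏ j ∈ s, (a + b * c j) = ∑ k ∈ Finset.range (s.card + 1),
      a ^ k * b ^ (s.card - k) * ∑ t ∈ s.powersetCard k, ∏ j ∈ s \ t, c j := by
  rw [Finset.prod_add, Finset.sum_powerset]
  refine Finset.sum_congr rfl fun k _ => ?_
  rw [Finset.mul_sum]
  refine Finset.sum_congr rfl fun t ht => ?_
  obtain ⟨hts, rfl⟩ := Finset.mem_powersetCard.1 ht
  rw [Finset.prod_const, Finset.prod_mul_distrib, Finset.prod_const,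
    Finset.card_sdiff_of_subset hts, mul_assoc]

theorem prod_erase_sub_mul_eq_sum (a b : R) (y : Fin N → R) (j : Fin N) :
    ∏ m ∈ Finset.univ.erase j, (a - b * y m) =
      ∑ k : Fin N, a ^ (k : ℕ) * b ^ staircase N k * eraseMatrix y k j := by
  have hcard : (Finset.univ.erase j).card = N - 1 := by
    rw [Finset.card_erase_of_mem (Finset.mem_univ j), Finset.card_fin]
  simp only [sub_eq_add_neg, ← mul_neg]
  rw [prod_add_mul_eq_sum_range, hcard, Nat.sub_add_cancel (Fin.pos j), Finset.sum_range]
  refine Finset.sum_congr rfl fun k _ => ?_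
  rw [staircase, Fin.val_rev, Nat.sub_sub, add_comm 1, eraseMatrix, Matrix.of_apply]

theorem vandermonde_mul_eraseMatrix (y : Fin N → R) :
    Matrix.vandermonde y * eraseMatrix y =
      Matrix.diagonal fun i => ∏ m ∈ Finset.univ.erase i, (y i - y m) := by
  ext i j
  have h := prod_erase_sub_mul_eq_sum (y i) 1 y j
  simp only [one_mul, one_pow, mul_one] at h
  simp only [Matrix.mul_apply, Matrix.vandermonde_apply, ← h, Matrix.diagonal_apply]
  split_ifs with hij
  · rw [hij]
  · exact Finset.prod_eq_zero (Finset.mem_erase.2 ⟨hij, Finset.mem_univ _⟩) (sub_self _)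

theorem prod_prod_erase_sub (y : Fin N → R) :
    ∏ i, ∏ j ∈ Finset.univ.erase i, (y i - y j) =
      (∏ i, ∏ j ∈ Finset.Ioi i, (y j - y i)) * ∏ i, ∏ j ∈ Finset.Ioi i, (y i - y j) := by
  have hsplit (i : Fin N) : ∏ j ∈ Finset.univ.erase i, (y i - y j) =
      (∏ j ∈ Finset.Iio i, (y i - y j)) * ∏ j ∈ Finset.Ioi i, (y i - y j) := by
    have hdisj : Disjoint (Finset.Iio i) (Finset.Ioi i) := Finset.disjoint_left.2 fun _ hj hj' =>
      lt_asymm (Finset.mem_Iio.1 hj) (Finset.mem_Ioi.1 hj')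
    rw [← Finset.prod_union hdisj]
    congr 1
    ext j
    simp
  simp only [hsplit, Finset.prod_mul_distrib]
  congr 1
  exact Finset.prod_comm' (by simp)

theorem det_eraseMatrix [IsDomain R] {y : Fin N → R} (hy : Function.Injective y) :
    (eraseMatrix y).det = alternant y (staircase N) := by
  refine mul_left_cancel₀ (Matrix.det_vandermonde_ne_zero_iff.2 hy) ?_
  rw [← Matrix.det_mul, vandermonde_mul_eraseMatrix, Matrix.det_diagonal, prod_prod_erase_sub,
    Matrix.det_vandermonde, alternant_staircase]

/-- Cauchy's determinant `det (1 / (1 - x_i y_j))`, with denominators cleared. -/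
theorem det_prod_erase_one_sub_mul [IsDomain R] (x : Fin N → R) {y : Fin N → R}
    (hy : Function.Injective y) :
    Matrix.det (Matrix.of fun i j => ∏ k ∈ Finset.univ.erase j, (1 - x i * y k)) =
      alternant x (staircase N) * alternant y (staircase N) := by
  have hfactor : (Matrix.of fun i j => ∏ k ∈ Finset.univ.erase j, (1 - x i * y k)) =
      (Matrix.of fun i j => x j ^ staircase N i).transpose * eraseMatrix y := by
    ext i j
    simp only [Matrix.of_apply, prod_erase_sub_mul_eq_sum, one_pow, one_mul, Matrix.mul_apply,
      Matrix.transpose_apply]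
  rw [hfactor, Matrix.det_mul, Matrix.det_transpose, det_eraseMatrix hy, ← alternant]

theorem mk_pow_mul_one_sub (a : R) :
    (PowerSeries.mk fun s => a ^ s) * (1 - PowerSeries.C a * PowerSeries.X) = 1 := by
  simpa [PowerSeries.rescale_mk, PowerSeries.rescale_X] using
    congrArg (PowerSeries.rescale a) (PowerSeries.mk_one_mul_one_sub_eq_one R)

theorem coeff_prod_mk_pow {ι : Type*} [Fintype ι] [DecidableEq ι] (z : ι → R) (m : ℕ) :
    PowerSeries.coeff m (∏ a, PowerSeries.mk fun s => z a ^ s) = completeSum m z := by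
  simp only [PowerSeries.coeff_prod, completeSum, PowerSeries.coeff_mk]

theorem det_mk_pow_mul [IsDomain R] (x : Fin N → R) {y : Fin N → R} (hy : Function.Injective y) :
    Matrix.det (Matrix.of fun i j => PowerSeries.mk fun s => (x i * y j) ^ s) =
      PowerSeries.C (alternant x (staircase N) * alternant y (staircase N)) *
        (∏ p : Fin N × Fin N, PowerSeries.mk fun s => (x p.1 * y p.2) ^ s) *
          PowerSeries.X ^ (∑ i, staircase N i) := by
  let x' : Fin N → PowerSeries R := fun i => PowerSeries.C (x i) * PowerSeries.X
  let y' : Fin N → PowerSeries R := PowerSeries.C ∘ y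
  have hinv (i j : Fin N) :
      (PowerSeries.mk fun s => (x i * y j) ^ s) * (1 - x' i * y' j) = 1 := by
    have h := mk_pow_mul_one_sub (x i * y j)
    rwa [map_mul, mul_right_comm] at h
  have hclear : (Matrix.of fun i j => PowerSeries.mk fun s => (x i * y j) ^ s) =
      Matrix.of fun i j => (∏ k, PowerSeries.mk fun s => (x i * y k) ^ s) *
        ∏ k ∈ Finset.univ.erase j, (1 - x' i * y' k) := by
    ext1 i j
    rw [Matrix.of_apply, Matrix.of_apply, ← Finset.mul_prod_erase _ _ (Finset.mem_univ j),
      mul_assoc, ← Finset.prod_mul_distrib, Finset.prod_congr rfl fun k _ => hinv i k,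
      Finset.prod_const_one, mul_one]
  have hdet := Matrix.det_mul_column
    (fun i => ∏ k, PowerSeries.mk fun s => (x i * y k) ^ s)
    (Matrix.of fun i j => ∏ k ∈ Finset.univ.erase j, (1 - x' i * y' k))
  simp only [Matrix.of_apply] at hdet
  rw [hclear, hdet, det_prod_erase_one_sub_mul x' (PowerSeries.C_injective.comp hy),
    alternant_mul, Fintype.prod_prod_type, map_mul, map_alternant, map_alternant]
  change _ * (_ * alternant (PowerSeries.C ∘ x) _ * _) = _
  ring

theorem alternant_mul_completeSum [IsDomain R] (x : Fin N → R) {y : Fin N → R}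
    (hy : Function.Injective y) (n : ℕ) :
    alternant x (staircase N) * alternant y (staircase N) *
        completeSum n (fun p : Fin N × Fin N => x p.1 * y p.2) =
      ∑ w : Perm (Fin N), ((Perm.sign w : ℤ) : R) *
        completeSum (n + ∑ i, staircase N i) fun i => x i * y (w i) := by
  have h := congrArg (PowerSeries.coeff (n + ∑ i, staircase N i)) (det_mk_pow_mul x hy)
  rw [PowerSeries.coeff_mul_X_pow, PowerSeries.coeff_C_mul, coeff_prod_mk_pow] at h
  rw [← h, ← Matrix.det_transpose, Matrix.det_apply', map_sum]
  refine Finset.sum_congr rfl fun w _ => ?_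
  rw [← coeff_prod_mk_pow, ← PowerSeries.coeff_C_mul, map_intCast]
  rfl

end Cauchy

section Frobenius

variable {ι R : Type*} [Fintype ι] [DecidableEq ι] [CommRing R] {N : ℕ}

/-- Frobenius' formula for the character indexed by `λ`, where `l = λ + δ`: the coefficient of
`x ^ l` in the product of the Vandermonde alternant with the power sums given by the cycle type
of `g`. -/
noncomputable def frobeniusChar (l : Fin N →₀ ℕ) (g : Perm ι) : ℤ :=
  MvPolynomial.coeff l (alternant MvPolynomial.X (staircase N) * fixedWordSum g MvPolynomial.X)

theorem coeff_alternant_mul_fixedWordSum (l : Fin N →₀ ℕ) (g : Perm ι) :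
    MvPolynomial.coeff l (alternant MvPolynomial.X (staircase N) *
      fixedWordSum g MvPolynomial.X : MvPolynomial (Fin N) R) = frobeniusChar l g := by
  have hX : MvPolynomial.map (Int.castRingHom R) ∘ MvPolynomial.X =
      (MvPolynomial.X : Fin N → MvPolynomial (Fin N) R) := funext (MvPolynomial.map_X _)
  rw [frobeniusChar, ← eq_intCast (Int.castRingHom R), ← MvPolynomial.coeff_map, map_mul,
    map_alternant, map_fixedWordSum, hX]

theorem alternant_X_eq_sum (e : Fin N → ℕ) :
    (alternant MvPolynomial.X e : MvPolynomial (Fin N) R) =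
      ∑ w : Perm (Fin N),
        MvPolynomial.monomial (Finsupp.equivFunOnFinite.symm (e ∘ w)) ((Perm.sign w : ℤ) : R) := by
  rw [alternant_eq_sum_perm_exponents]
  refine Finset.sum_congr rfl fun w _ => ?_
  have hmonomial := prod_X_pow_eq_monomial (R := R) (Finsupp.equivFunOnFinite.symm (e ∘ w))
  simp only [Finsupp.coe_equivFunOnFinite_symm, Function.comp_apply] at hmonomial
  rw [hmonomial, ← map_intCast (MvPolynomial.C (σ := Fin N) (R := R)),
    MvPolynomial.C_mul_monomial, mul_one]

theorem coeff_alternant_X_self {l : Fin N →₀ ℕ} (hl : Function.Injective l) :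
    MvPolynomial.coeff l (alternant MvPolynomial.X l : MvPolynomial (Fin N) R) = 1 := by
  rw [alternant_X_eq_sum, MvPolynomial.coeff_sum, Finset.sum_eq_single 1]
  · have hself : Finsupp.equivFunOnFinite.symm (⇑l ∘ (1 : Perm (Fin N))) = l :=
      Finsupp.ext fun _ => rfl
    rw [hself, MvPolynomial.coeff_monomial, if_pos rfl, Perm.sign_one, Units.val_one, Int.cast_one]
  · intro w _ hw
    rw [MvPolynomial.coeff_monomial, if_neg]
    exact fun h => hw (Equiv.ext fun i => hl (DFunLike.congr_fun h i))
  · exact fun h => absurd (Finset.mem_univ _) h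

theorem frobeniusChar_eq_sum (l : Fin N →₀ ℕ) (g : Perm ι) :
    frobeniusChar l g = ∑ w : Perm (Fin N), (Perm.sign w : ℤ) *
      (Finset.univ.filter fun f : ι → Fin N =>
        f ∘ g = f ∧ ∀ r, content f r + staircase N (w r) = l r).card := by
  rw [frobeniusChar, alternant_X_eq_sum, Finset.sum_mul, MvPolynomial.coeff_sum]
  refine Finset.sum_congr rfl fun w _ => ?_
  simp only [fixedWordSum, ← monomial_content, Finset.mul_sum, MvPolynomial.coeff_sum,
    MvPolynomial.monomial_mul, mul_one, MvPolynomial.coeff_monomial]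
  rw [← Finset.sum_filter, Finset.sum_const, Finset.filter_filter, nsmul_eq_mul, mul_comm]
  congr 4 with f
  refine and_congr_right fun _ => ?_
  simp only [DFunLike.ext_iff, Finsupp.add_apply, Finsupp.coe_equivFunOnFinite_symm,
    Function.comp_apply, add_comm]

theorem coeff_completeSum_X_mul_C {σ : Type*} [Fintype σ] [DecidableEq σ] (z : σ → R)
    (l : σ →₀ ℕ) :
    MvPolynomial.coeff l (completeSum (∑ i, l i) fun i =>
      MvPolynomial.X i * MvPolynomial.C (z i)) = ∏ i, z i ^ l i := by
  have hterm (c : σ →₀ ℕ) : ∏ i, (MvPolynomial.X i * MvPolynomial.C (z i)) ^ c i =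
      MvPolynomial.monomial c (∏ i, z i ^ c i) := by
    simp only [mul_pow, Finset.prod_mul_distrib, prod_X_pow_eq_monomial, ← map_pow, ← map_prod]
    rw [mul_comm, MvPolynomial.C_mul_monomial, mul_one]
  simp only [completeSum, hterm, MvPolynomial.coeff_sum, MvPolynomial.coeff_monomial]
  rw [Finset.sum_ite_eq', if_pos]
  exact Finset.mem_finsuppAntidiag.2 ⟨rfl, Finset.subset_univ _⟩

theorem alternant_mul_sum_fixedWordSum_mul [IsDomain R] (x : Fin N → R) {y : Fin N → R}
    (hy : Function.Injective y) :
    alternant x (staircase N) * alternant y (staircase N) *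
        ∑ g : Perm ι, fixedWordSum g x * fixedWordSum g y =
      (Fintype.card ι).factorial * ∑ w : Perm (Fin N), ((Perm.sign w : ℤ) : R) *
        completeSum (Fintype.card ι + ∑ i, staircase N i) fun i => x i * y (w i) := by
  simp only [fixedWordSum_mul, sum_fixedWordSum, ← alternant_mul_completeSum x hy]
  ring

theorem alternant_mul_sum_frobeniusChar [IsDomain R] {l : Fin N →₀ ℕ}
    (hl : ∑ i, l i = Fintype.card ι + ∑ i, staircase N i) {y : Fin N → R}
    (hy : Function.Injective y) :
    alternant y (staircase N) * ∑ g : Perm ι, (frobeniusChar l g : R) * fixedWordSum g y =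
      (Fintype.card ι).factorial * alternant y l := by
  have hcauchy := alternant_mul_sum_fixedWordSum_mul (ι := ι) MvPolynomial.X
    (y := MvPolynomial.C (σ := Fin N) ∘ y) ((MvPolynomial.C_injective _ _).comp hy)
  have hcoeff := congrArg (MvPolynomial.coeff l) hcauchy
  have hfactor (g : Perm ι) :
      alternant MvPolynomial.X (staircase N) * MvPolynomial.C (alternant y (staircase N)) *
        (fixedWordSum g MvPolynomial.X * MvPolynomial.C (fixedWordSum g y)) =
      MvPolynomial.C (alternant y (staircase N) * fixedWordSum g y) *
        (alternant MvPolynomial.X (staircase N) * fixedWordSum g MvPolynomial.X) := by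
    rw [map_mul]
    ring
  simp only [← hl, ← map_alternant, ← map_fixedWordSum, Function.comp_apply, Finset.mul_sum,
    hfactor, MvPolynomial.coeff_sum, MvPolynomial.coeff_C_mul, coeff_alternant_mul_fixedWordSum]
    at hcoeff
  simp only [← map_natCast (MvPolynomial.C (σ := Fin N) (R := R)),
    ← map_intCast (MvPolynomial.C (σ := Fin N) (R := R)), MvPolynomial.coeff_C_mul,
    coeff_completeSum_X_mul_C] at hcoeff
  rw [alternant_eq_sum_perm_variables y l, Finset.mul_sum, Finset.mul_sum, ← hcoeff]
  exact Finset.sum_congr rfl fun g _ => by ring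

theorem sum_frobeniusChar_sq {l : Fin N →₀ ℕ}
    (hl : ∑ i, l i = Fintype.card ι + ∑ i, staircase N i) (hinj : Function.Injective l) :
    ∑ g : Perm ι, frobeniusChar l g ^ 2 = (Fintype.card ι).factorial := by
  have hcoeff := congrArg (MvPolynomial.coeff l) <| alternant_mul_sum_frobeniusChar hl
    (MvPolynomial.X_injective (σ := Fin N) (R := ℤ))
  simp only [Finset.mul_sum, mul_left_comm (alternant _ _),
    ← map_intCast (MvPolynomial.C (σ := Fin N) (R := ℤ)),
    ← map_natCast (MvPolynomial.C (σ := Fin N) (R := ℤ)), MvPolynomial.coeff_sum,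
    MvPolynomial.coeff_C_mul, coeff_alternant_X_self hinj, mul_one,
    coeff_alternant_mul_fixedWordSum, Int.cast_id] at hcoeff
  simpa only [sq] using hcoeff

end Frobenius

section Hooks

variable {N : ℕ}

theorem staircase_add (i : Fin N) : staircase N i + i + 1 = N := by
  rw [staircase, Fin.val_rev]
  omega

theorem strictAnti_staircase : StrictAnti (staircase N) := fun i j h => by
  have := staircase_add i
  have := staircase_add j
  have : (i : ℕ) < j := h
  omega

theorem prod_Ioi_staircase_sub {M : Type*} [CommMonoid M] (φ : ℕ → M) (i : Fin N) :
    ∏ j ∈ Finset.Ioi i, φ (staircase N i - staircase N j) =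
      ∏ s ∈ Finset.Icc 1 (staircase N i), φ s := by
  have hi := staircase_add i
  refine Finset.prod_nbij (fun j => staircase N i - staircase N j) ?_ ?_ ?_ fun _ _ => rfl
  · intro j hj
    have := strictAnti_staircase (Finset.mem_Ioi.1 hj)
    exact Finset.mem_Icc.2 ⟨by omega, by omega⟩
  · intro j hj j' hj' h
    have := strictAnti_staircase (Finset.mem_Ioi.1 hj)
    have := strictAnti_staircase (Finset.mem_Ioi.1 hj')
    exact strictAnti_staircase.injective (by grind)
  · intro s hs
    have hs' := Finset.mem_Icc.1 hs
    have hlt : i + s < N := by omega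
    have := staircase_add (⟨i + s, hlt⟩ : Fin N)
    exact ⟨⟨i + s, hlt⟩, Finset.mem_coe.2 (Finset.mem_Ioi.2 (Fin.lt_def.2 (by grind))), by grind⟩

variable (μ : YoungDiagram)

/-- The strictly decreasing sequence `λ + δ`, with entries `λ_i + (N - 1 - i)`. It determines
`λ`, and `a_{λ + δ}` is the numerator of the Schur polynomial of `λ` in `N` variables. -/
noncomputable def shiftedParts (N : ℕ) : Fin N →₀ ℕ :=
  Finsupp.equivFunOnFinite.symm fun i => μ.rowLen i + staircase N i

theorem shiftedParts_apply (i : Fin N) : shiftedParts μ N i = μ.rowLen i + staircase N i := rfl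

theorem strictAnti_shiftedParts : StrictAnti (shiftedParts μ N) := fun _ _ h =>
  add_lt_add_of_le_of_lt (μ.rowLen_anti _ _ (Fin.le_def.1 h.le)) (strictAnti_staircase h)

theorem lt_rowLen_iff_lt_colLen {r c : ℕ} : c < μ.rowLen r ↔ r < μ.colLen c := by
  rw [← YoungDiagram.mem_iff_lt_rowLen, YoungDiagram.mem_iff_lt_colLen]

theorem rowLen_eq_zero {r : ℕ} (hr : μ.colLen 0 ≤ r) : μ.rowLen r = 0 :=
  Nat.eq_zero_of_not_pos fun h => hr.not_gt ((lt_rowLen_iff_lt_colLen μ).1 h)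

theorem prod_cells_eq {M : Type*} [CommMonoid M] (hN : μ.colLen 0 ≤ N) (φ : ℕ × ℕ → M) :
    ∏ c ∈ μ.cells, φ c = ∏ i : Fin N, ∏ c ∈ Finset.range (μ.rowLen i), φ (i, c) := by
  rw [Fin.prod_univ_eq_prod_range (fun i => ∏ c ∈ Finset.range (μ.rowLen i), φ (i, c))]
  refine Finset.prod_finset_product _ _ _ fun c => ?_
  rw [Finset.mem_range, Finset.mem_range, YoungDiagram.mem_cells, YoungDiagram.mem_iff_lt_rowLen]
  refine ⟨fun h => ⟨?_, h⟩, And.right⟩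
  exact ((lt_rowLen_iff_lt_colLen μ).1 h).trans_le ((μ.colLen_anti _ _ (Nat.zero_le _)).trans hN)

theorem sum_shiftedParts (hN : μ.colLen 0 ≤ N) :
    ∑ i, shiftedParts μ N i = μ.card + ∑ i, staircase N i := by
  have hcard := congrArg Multiplicative.toAdd (prod_cells_eq μ hN fun _ => Multiplicative.ofAdd 1)
  simp only [Finset.prod_const, Finset.card_range, toAdd_prod, toAdd_pow, toAdd_ofAdd, smul_eq_mul,
    mul_one] at hcard
  simp only [shiftedParts_apply, Finset.sum_add_distrib, ← hcard]

theorem sum_mul_shiftedParts (hN : μ.colLen 0 ≤ N) :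
    ∑ i : Fin N, i * shiftedParts μ N i = nStat μ + ∑ i : Fin N, i * staircase N i := by
  simp only [shiftedParts_apply, mul_add, Finset.sum_add_distrib]
  congr 1
  rw [Fin.sum_univ_eq_sum_range (fun i => i * μ.rowLen i), nStat]
  refine (Finset.sum_subset (Finset.range_mono hN) fun r _ hr => ?_).symm
  rw [rowLen_eq_zero μ (not_lt.1 (mt Finset.mem_range.2 hr)), mul_zero]

variable {μ}

theorem hookLength_add {r c : ℕ} (hc : c < μ.rowLen r) :
    hookLength μ (r, c) + c + r + 1 = μ.rowLen r + μ.colLen c := by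
  have := (lt_rowLen_iff_lt_colLen μ).1 hc
  simp only [hookLength]
  omega

theorem hookLength_le (i : Fin N) {c : ℕ} (hN : μ.colLen 0 ≤ N) (hc : c < μ.rowLen i) :
    hookLength μ (i, c) ≤ shiftedParts μ N i := by
  have := hookLength_add hc
  have := μ.colLen_anti 0 c (Nat.zero_le _)
  have := staircase_add i
  rw [shiftedParts_apply]
  omega

theorem strictAntiOn_hookLength_row (r : ℕ) :
    StrictAntiOn (fun c => hookLength μ (r, c)) (Finset.range (μ.rowLen r)) := by
  intro c hc c' hc' h
  have := hookLength_add (Finset.mem_range.1 hc)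
  have := hookLength_add (Finset.mem_range.1 hc')
  have := μ.colLen_anti c c' h.le
  grind

theorem hookLength_ne_shiftedParts_sub {i j : Fin N} (hij : i < j) {c : ℕ}
    (hc : c < μ.rowLen i) :
    hookLength μ (i, c) ≠ shiftedParts μ N i - shiftedParts μ N j := by
  have := hookLength_add hc
  have hlt := strictAnti_shiftedParts μ hij
  have := Fin.lt_def.1 hij
  have := staircase_add i
  have := staircase_add j
  have hiff := lt_rowLen_iff_lt_colLen μ (r := j) (c := c)
  rw [shiftedParts_apply, shiftedParts_apply] at hlt ⊢
  omega

theorem injOn_shiftedParts_sub (i : Fin N) :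
    Set.InjOn (fun j => shiftedParts μ N i - shiftedParts μ N j)
      (Finset.Ioi i : Finset (Fin N)) := by
  intro j hj j' hj' h
  have := strictAnti_shiftedParts μ (Finset.mem_Ioi.1 hj)
  have := strictAnti_shiftedParts μ (Finset.mem_Ioi.1 hj')
  exact (strictAnti_shiftedParts μ).injective (by grind)

theorem disjoint_image_hookLength_image_sub (i : Fin N) :
    Disjoint ((Finset.range (μ.rowLen i)).image fun c => hookLength μ (i, c))
      ((Finset.Ioi i).image fun j => shiftedParts μ N i - shiftedParts μ N j) := by
  rw [Finset.disjoint_left]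
  rintro s hs hs'
  obtain ⟨c, hc, rfl⟩ := Finset.mem_image.1 hs
  obtain ⟨j, hj, h⟩ := Finset.mem_image.1 hs'
  exact hookLength_ne_shiftedParts_sub (Finset.mem_Ioi.1 hj) (Finset.mem_range.1 hc) h.symm

theorem image_hookLength_union_image_sub (hN : μ.colLen 0 ≤ N) (i : Fin N) :
    ((Finset.range (μ.rowLen i)).image fun c => hookLength μ (i, c)) ∪
        ((Finset.Ioi i).image fun j => shiftedParts μ N i - shiftedParts μ N j) =
      Finset.Icc 1 (shiftedParts μ N i) := by
  refine Finset.eq_of_subset_of_card_le (Finset.union_subset ?_ ?_) ?_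
  · refine Finset.image_subset_iff.2 fun c hc => Finset.mem_Icc.2 ⟨Nat.le_add_left _ _, ?_⟩
    exact hookLength_le i hN (Finset.mem_range.1 hc)
  · refine Finset.image_subset_iff.2 fun j hj => Finset.mem_Icc.2 ⟨?_, Nat.sub_le _ _⟩
    exact Nat.sub_pos_of_lt (strictAnti_shiftedParts μ (Finset.mem_Ioi.1 hj))
  · rw [Finset.card_union_of_disjoint (disjoint_image_hookLength_image_sub i),
      Finset.card_image_of_injOn (strictAntiOn_hookLength_row _).injOn,
      Finset.card_image_of_injOn (injOn_shiftedParts_sub i), Finset.card_range, Nat.card_Icc,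
      Fin.card_Ioi, shiftedParts_apply]
    have := staircase_add i
    omega

theorem prod_hookLength_mul_prod_sub {M : Type*} [CommMonoid M] (hN : μ.colLen 0 ≤ N)
    (φ : ℕ → M) (i : Fin N) :
    (∏ c ∈ Finset.range (μ.rowLen i), φ (hookLength μ (i, c))) *
        ∏ j ∈ Finset.Ioi i, φ (shiftedParts μ N i - shiftedParts μ N j) =
      ∏ s ∈ Finset.Icc 1 (shiftedParts μ N i), φ s := by
  rw [← Finset.prod_image (f := φ) (strictAntiOn_hookLength_row _).injOn,
    ← Finset.prod_image (f := φ) (injOn_shiftedParts_sub i),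
    ← Finset.prod_union (disjoint_image_hookLength_image_sub i),
    image_hookLength_union_image_sub hN]

end Hooks

section PrincipalSpecialization

variable {R : Type*} [CommRing R] {N : ℕ}

theorem alternant_pow {e : Fin N → ℕ} (he : StrictAnti e) (q : R) :
    alternant (fun j : Fin N => q ^ (j : ℕ)) e =
      q ^ (∑ j : Fin N, j * e j) * ∏ i, ∏ j ∈ Finset.Ioi i, (1 - q ^ (e i - e j)) := by
  have hvandermonde : alternant (fun j : Fin N => q ^ (j : ℕ)) e =
      (Matrix.vandermonde fun i => q ^ e i).det := by
    rw [alternant]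
    congr 1
    ext1 i j
    rw [Matrix.of_apply, Matrix.vandermonde_apply, ← pow_mul, ← pow_mul, mul_comm]
  have hfactor (i : Fin N) : ∀ j ∈ Finset.Ioi i,
      q ^ e j - q ^ e i = q ^ e j * (1 - q ^ (e i - e j)) := fun j hj => by
    rw [mul_sub, mul_one, ← pow_add, Nat.add_sub_cancel' (he (Finset.mem_Ioi.1 hj)).le]
  rw [hvandermonde, Matrix.det_vandermonde,
    Finset.prod_congr rfl fun i _ => Finset.prod_congr rfl (hfactor i)]
  simp only [Finset.prod_mul_distrib]
  congr 1
  rw [Finset.prod_comm' (t' := Finset.univ) (s' := fun j => Finset.Iio j) (by simp),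
    ← Finset.prod_pow_eq_pow_sum]
  refine Finset.prod_congr rfl fun j _ => ?_
  rw [Finset.prod_const, Fin.card_Iio, ← pow_mul, mul_comm]

theorem alternant_shiftedParts_mul_prod_hookLength {μ : YoungDiagram} (hN : μ.colLen 0 ≤ N)
    (q : R) :
    alternant (fun j : Fin N => q ^ (j : ℕ)) (shiftedParts μ N) *
        ∏ c ∈ μ.cells, (1 - q ^ hookLength μ c) =
      q ^ nStat μ * alternant (fun j : Fin N => q ^ (j : ℕ)) (staircase N) *
        ∏ i : Fin N, ∏ s ∈ Finset.Ioc (staircase N i) (shiftedParts μ N i), (1 - q ^ s) := by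
  have hhook : (∏ c ∈ μ.cells, (1 - q ^ hookLength μ c)) *
        ∏ i, ∏ j ∈ Finset.Ioi i, (1 - q ^ (shiftedParts μ N i - shiftedParts μ N j)) =
      (∏ i, ∏ j ∈ Finset.Ioi i, (1 - q ^ (staircase N i - staircase N j))) *
        ∏ i : Fin N, ∏ s ∈ Finset.Ioc (staircase N i) (shiftedParts μ N i), (1 - q ^ s) := by
    rw [prod_cells_eq μ hN, ← Finset.prod_mul_distrib, ← Finset.prod_mul_distrib]
    refine Finset.prod_congr rfl fun i _ => ?_
    rw [prod_hookLength_mul_prod_sub hN (fun s => 1 - q ^ s),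
      prod_Ioi_staircase_sub (fun s => 1 - q ^ s)]
    exact (Finset.prod_Ioc_consecutive (fun s => 1 - q ^ s) (Nat.zero_le _)
      (Nat.le_add_left _ _)).symm
  rw [alternant_pow strictAnti_staircase, alternant_pow (strictAnti_shiftedParts μ),
    sum_mul_shiftedParts μ hN, pow_add]
  linear_combination (q ^ nStat μ * q ^ (∑ i : Fin N, i * staircase N i)) * hhook

end PrincipalSpecialization

section HookSeries

open PowerSeries

variable {R : Type*} [CommRing R] {N : ℕ}

theorem X_pow_dvd_prod_one_sub_X_pow_sub_one {κ : Type*} {t : Finset κ} {e : κ → ℕ} {d : ℕ}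
    (he : ∀ a ∈ t, d ≤ e a) : (X : R⟦X⟧) ^ d ∣ ∏ a ∈ t, (1 - X ^ e a) - 1 := by
  refine Finset.prod_induction _ (fun p => (X : R⟦X⟧) ^ d ∣ p - 1) (fun p q hp hq => ?_)
    (by rw [sub_self]; exact dvd_zero _) fun a ha => ?_
  · rw [show p * q - 1 = p * (q - 1) + (p - 1) by ring]
    exact dvd_add (hq.mul_left _) hp
  · rw [show (1 - X ^ e a - 1 : R⟦X⟧) = -X ^ e a by ring]
    exact (pow_dvd_pow _ (he a ha)).neg_right

/-- The expansion of `1 / (1 - X ^ h)` for `h ≠ 0`. -/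
def geometricSeries (h : ℕ) : R⟦X⟧ :=
  PowerSeries.mk fun s => if h ∣ s then 1 else 0

theorem geometricSeries_mul_one_sub_X_pow {h : ℕ} (hh : 0 < h) :
    (geometricSeries h : R⟦X⟧) * (1 - X ^ h) = 1 := by
  ext m
  rw [geometricSeries, mul_sub, mul_one, map_sub, coeff_mul_X_pow', coeff_mk, coeff_one]
  by_cases hm : h ≤ m
  · simp only [if_pos hm, coeff_mk, Nat.dvd_sub_iff_left hm dvd_rfl, sub_self,
      if_neg (hh.trans_le hm).ne']
  · rw [if_neg hm, sub_zero]
    congr 1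
    exact propext ⟨fun hd => Nat.eq_zero_of_dvd_of_lt hd (not_le.1 hm), fun h0 => h0 ▸ dvd_zero h⟩

variable {κ : Type*} [Fintype κ]

theorem coeff_prod_geometricSeries {h : κ → ℕ} (hh : ∀ i, 0 < h i) (m : ℕ) :
    coeff m (∏ i, (geometricSeries (h i) : R⟦X⟧)) =
      Set.ncard {y : κ → ℕ | ∑ i, h i * y i = m} := by
  classical
  rw [coeff_prod]
  simp only [geometricSeries, coeff_mk, Finset.prod_ite_zero, Finset.prod_const_one]
  rw [Finset.sum_boole, ← Set.ncard_coe_finset]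
  congr 1
  refine (Set.ncard_congr
    (fun y _ => Finsupp.equivFunOnFinite.symm fun i => h i * y i) ?_ ?_ ?_).symm
  · intro y hy
    simpa using hy
  · intro y y' _ _ heq
    exact funext fun i => Nat.eq_of_mul_eq_mul_left (hh i) (DFunLike.congr_fun heq i)
  · intro c hc
    simp only [Finset.coe_filter, Finset.mem_finsuppAntidiag, Set.mem_ofPred_eq, Finset.mem_univ,
      true_imp_iff] at hc
    choose y hy using hc.2
    refine ⟨y, ?_, Finsupp.ext fun i => (hy i).symm⟩
    rw [Set.mem_ofPred_eq, ← hc.1.1]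
    exact Finset.sum_congr rfl fun i _ => (hy i).symm

theorem coeff_X_pow_mul_prod_geometricSeries {h : κ → ℕ} (hh : ∀ i, 0 < h i) (m d : ℕ) :
    coeff d ((X : R⟦X⟧) ^ m * ∏ i, (geometricSeries (h i) : R⟦X⟧)) =
      Set.ncard {y : κ → ℕ | ∑ i, (h i : ℤ) * (y i : ℤ) = (d : ℤ) - (m : ℤ)} := by
  rw [coeff_X_pow_mul']
  split_ifs with hmd
  · rw [coeff_prod_geometricSeries hh]
    congr 2
    ext y
    rw [Set.mem_ofPred_eq, Set.mem_ofPred_eq, ← Nat.cast_sub hmd]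
    norm_cast
  · have hempty : {y : κ → ℕ | ∑ i, (h i : ℤ) * (y i : ℤ) = (d : ℤ) - (m : ℤ)} = ∅ := by
      refine Set.eq_empty_of_forall_notMem fun y hy => ?_
      have hnonneg : (0 : ℤ) ≤ ∑ i, (h i : ℤ) * (y i : ℤ) :=
        Finset.sum_nonneg fun i _ => by positivity
      rw [Set.mem_ofPred_eq] at hy
      omega
    rw [hempty, Set.ncard_empty]
    exact Nat.cast_zero.symm

theorem X_pow_dvd_prod_Ioc_sub_one {μ : YoungDiagram} {d : ℕ} (hN : μ.colLen 0 + d ≤ N) :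
    (X : R⟦X⟧) ^ (d + 1) ∣
      ∏ i : Fin N, ∏ s ∈ Finset.Ioc (staircase N i) (shiftedParts μ N i), (1 - X ^ s) - 1 := by
  rw [Finset.prod_sigma']
  refine X_pow_dvd_prod_one_sub_X_pow_sub_one fun a ha => ?_
  obtain ⟨hlt, hle⟩ := Finset.mem_Ioc.1 (Finset.mem_sigma.1 ha).2
  have := staircase_add a.1
  by_cases hrow : μ.colLen 0 ≤ a.1
  · rw [shiftedParts_apply, rowLen_eq_zero μ hrow] at hle
    omega
  · omega

theorem X_pow_injective [Nontrivial R] : Function.Injective fun k : ℕ => (X : R⟦X⟧) ^ k := by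
  intro a b hab
  have hcoeff := congrArg (coeff a) hab
  simp only [coeff_X_pow, if_true] at hcoeff
  by_contra hne
  exact one_ne_zero (hcoeff.trans (if_neg hne))

theorem alternant_X_pow_ne_zero [IsDomain R] :
    alternant (fun j : Fin N => (X : R⟦X⟧) ^ (j : ℕ)) (staircase N) ≠ 0 :=
  alternant_staircase_ne_zero fun _ _ h => Fin.ext (X_pow_injective h)

theorem coeff_eq_mul_ncard_of_alternant_mul_eq [IsDomain R] {μ : YoungDiagram} {d : ℕ}
    (hN : μ.colLen 0 + d ≤ N) (box : κ ≃ μ.cells) {F : R⟦X⟧} {K : R}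
    (hF : alternant (fun j : Fin N => (X : R⟦X⟧) ^ (j : ℕ)) (staircase N) * F =
      C K * alternant (fun j : Fin N => (X : R⟦X⟧) ^ (j : ℕ)) (shiftedParts μ N)) :
    coeff d F = K * Set.ncard {y : κ → ℕ |
      ∑ i, (hookLength μ (box i) : ℤ) * (y i : ℤ) = (d : ℤ) - (nStat μ : ℤ)} := by
  have hpos (i) : 0 < hookLength μ (box i) := Nat.succ_pos _
  set P : R⟦X⟧ := ∏ i, geometricSeries (hookLength μ (box i)) with hP
  set T : R⟦X⟧ := ∏ i : Fin N,
    ∏ s ∈ Finset.Ioc (staircase N i) (shiftedParts μ N i), (1 - X ^ s)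
  have hinv : (∏ c ∈ μ.cells, (1 - X ^ hookLength μ c : R⟦X⟧)) * P = 1 := by
    rw [← Finset.prod_coe_sort, ← Equiv.prod_comp box, hP, ← Finset.prod_mul_distrib]
    exact Finset.prod_eq_one fun i _ => by rw [mul_comm, geometricSeries_mul_one_sub_X_pow (hpos i)]
  have hhook := alternant_shiftedParts_mul_prod_hookLength ((Nat.le_add_right _ d).trans hN)
    (X : R⟦X⟧)
  have hFT : F = C K * (X ^ nStat μ * P) * T := by
    refine mul_left_cancel₀ alternant_X_pow_ne_zero (hF.trans ?_)
    linear_combination (C K * P) * hhook - (C K * alternant _ (shiftedParts μ N)) * hinv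
  have htrunc : (X : R⟦X⟧) ^ (d + 1) ∣ F - C K * (X ^ nStat μ * P) := by
    rw [hFT, ← mul_sub_one]
    exact (X_pow_dvd_prod_Ioc_sub_one hN).mul_left _
  have hcoeff := X_pow_dvd_iff.1 htrunc d (Nat.lt_succ_self d)
  rw [map_sub, sub_eq_zero] at hcoeff
  rw [hcoeff, coeff_C_mul, coeff_X_pow_mul_prod_geometricSeries hpos]

end HookSeries

section ColumnCombinatorics

variable {μ : YoungDiagram} {n : ℕ} (t : Tableau μ n)

/-- The row, counted from `0`, that contains the entry `i` of the tableau `t`. -/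
def Tableau.rowOf (i : Fin n) : ℕ := (t i).1.1

/-- The column, counted from `0`, that contains the entry `i` of the tableau `t`. -/
def Tableau.colOf (i : Fin n) : ℕ := (t i).1.2

/-- No letter of the word `f` is repeated within a column of `t`. -/
def Tableau.ColumnInjective (f : Fin n → ℕ) : Prop :=
  ∀ i j, t.colOf i = t.colOf j → f i = f j → i = j

theorem Tableau.card_eq (t : Tableau μ n) : μ.card = n := by
  rw [YoungDiagram.card, ← Fintype.card_coe, ← Fintype.card_congr t, Fintype.card_fin]

theorem Tableau.rowOf_lt (i : Fin n) : t.rowOf i < μ.colLen (t.colOf i) :=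
  YoungDiagram.mem_iff_lt_colLen.1 ((YoungDiagram.mem_cells _).1 (t i).2)

theorem Tableau.eq_of_rowOf_eq_of_colOf_eq {i j : Fin n} (hrow : t.rowOf i = t.rowOf j)
    (hcol : t.colOf i = t.colOf j) : i = j :=
  t.injective (Subtype.ext (Prod.ext hrow hcol))

theorem Tableau.exists_rowOf_eq_and_colOf_eq {r c : ℕ} (h : r < μ.colLen c) :
    ∃ i, t.rowOf i = r ∧ t.colOf i = c := by
  refine ⟨t.symm ⟨(r, c), (YoungDiagram.mem_cells _).2 (YoungDiagram.mem_iff_lt_colLen.2 h)⟩, ?_⟩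
  rw [Tableau.rowOf, Tableau.colOf, Equiv.apply_symm_apply]
  exact ⟨rfl, rfl⟩

variable {t}

theorem Tableau.mem_colStabilizer {π : Perm (Fin n)} :
    π ∈ t.colStabilizer ↔ ∀ i, t.colOf (π i) = t.colOf i := by
  rw [Tableau.colStabilizer, Finset.mem_filter, and_iff_right (Finset.mem_univ π)]
  rfl

theorem Tableau.one_mem_colStabilizer : 1 ∈ t.colStabilizer :=
  Tableau.mem_colStabilizer.2 fun _ => rfl

theorem Tableau.mul_mem_colStabilizer {π τ : Perm (Fin n)} (hπ : π ∈ t.colStabilizer)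
    (hτ : τ ∈ t.colStabilizer) : π * τ ∈ t.colStabilizer :=
  Tableau.mem_colStabilizer.2 fun i => (Tableau.mem_colStabilizer.1 hπ (τ i)).trans
    (Tableau.mem_colStabilizer.1 hτ i)

theorem Tableau.inv_mem_colStabilizer {π : Perm (Fin n)} (hπ : π ∈ t.colStabilizer) :
    π⁻¹ ∈ t.colStabilizer :=
  Tableau.mem_colStabilizer.2 fun i => by
    rw [← Tableau.mem_colStabilizer.1 hπ, Perm.inv_def, Equiv.apply_symm_apply]

theorem Tableau.swap_mem_colStabilizer {i j : Fin n} (h : t.colOf i = t.colOf j) :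
    swap i j ∈ t.colStabilizer :=
  Tableau.mem_colStabilizer.2 fun _ => apply_swap_eq_self h _

theorem Tableau.ColumnInjective.card_filter_lt_le {f : Fin n → ℕ} (hf : t.ColumnInjective f)
    (r c : ℕ) :
    (Finset.univ.filter fun i => f i < r ∧ t.colOf i = c).card ≤
      (Finset.univ.filter fun i => t.rowOf i < r ∧ t.colOf i = c).card := by
  rcases le_or_gt r (μ.colLen c) with hr | hr
  · choose! φ hφ using fun i (hi : f i < r) =>
      t.exists_rowOf_eq_and_colOf_eq (hi.trans_le hr)
    refine Finset.card_le_card_of_injOn φ (fun i hi => ?_) fun i hi j hj hij => ?_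
    · obtain ⟨hlt, -⟩ := (Finset.mem_filter_univ i).1 hi
      exact (Finset.mem_filter_univ _).2 ⟨(hφ i hlt).1.trans_lt hlt, (hφ i hlt).2⟩
    · obtain ⟨hi, hci⟩ := (Finset.mem_filter_univ i).1 hi
      obtain ⟨hj, hcj⟩ := (Finset.mem_filter_univ j).1 hj
      refine hf i j (hci.trans hcj.symm) ?_
      rw [← (hφ i hi).1, hij, (hφ j hj).1]
  · refine Finset.card_le_card <| Finset.monotone_filter_right _ fun i _ hi => ⟨?_, hi.2⟩
    exact (t.rowOf_lt i).trans (hi.2 ▸ hr)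

theorem Tableau.ColumnInjective.lt_colLen {f : Fin n → ℕ} (hf : t.ColumnInjective f)
    (hdom : ∀ r, (Finset.univ.filter fun i => t.rowOf i < r).card ≤
      (Finset.univ.filter fun i => f i < r).card) (i : Fin n) :
    f i < μ.colLen (t.colOf i) := by
  by_contra hi
  set r := μ.colLen (t.colOf i) with hr
  have hcard (F : Fin n → ℕ) : (Finset.univ.filter fun j => F j < r).card =
      ∑ c ∈ Finset.univ.image t.colOf,
        (Finset.univ.filter fun j => F j < r ∧ t.colOf j = c).card := by
    rw [Finset.card_eq_sum_card_fiberwise (f := t.colOf) (t := Finset.univ.image t.colOf)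
      fun j _ => Finset.mem_image_of_mem _ (Finset.mem_univ j)]
    simp only [Finset.filter_filter]
  have hlt : (Finset.univ.filter fun j => f j < r ∧ t.colOf j = t.colOf i).card <
      (Finset.univ.filter fun j => t.rowOf j < r ∧ t.colOf j = t.colOf i).card := by
    refine Finset.card_lt_card <| (Finset.ssubset_iff_of_subset ?_).2 ⟨i, ?_, ?_⟩
    · refine Finset.monotone_filter_right _ fun j _ hj => ⟨?_, hj.2⟩
      rw [hr, ← hj.2]
      exact t.rowOf_lt j
    · exact (Finset.mem_filter_univ i).2 ⟨t.rowOf_lt i, rfl⟩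
    · exact fun hmem => hi ((Finset.mem_filter_univ i).1 hmem).1
  refine (hdom r).not_gt ?_
  rw [hcard, hcard]
  exact Finset.sum_lt_sum (fun c _ => hf.card_filter_lt_le r c)
    ⟨_, Finset.mem_image_of_mem _ (Finset.mem_univ i), hlt⟩

theorem Tableau.ColumnInjective.exists_eq_rowOf {f : Fin n → ℕ} (hf : t.ColumnInjective f)
    (hdom : ∀ r, (Finset.univ.filter fun i => t.rowOf i < r).card ≤
      (Finset.univ.filter fun i => f i < r).card) :
    ∃ π ∈ t.colStabilizer, ∀ i, f i = t.rowOf (π i) := by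
  choose φ hφ using fun i => t.exists_rowOf_eq_and_colOf_eq (hf.lt_colLen hdom i)
  have hinj : Function.Injective φ := fun i j hij => by
    refine hf i j ?_ ?_
    · rw [← (hφ i).2, hij, (hφ j).2]
    · rw [← (hφ i).1, hij, (hφ j).1]
  exact ⟨Equiv.ofBijective φ (Finite.injective_iff_bijective.1 hinj),
    Tableau.mem_colStabilizer.2 fun i => (hφ i).2, fun i => (hφ i).1.symm⟩

end ColumnCombinatorics

section Antisymmetrizer

variable {μ : YoungDiagram} {n : ℕ} (t : Tableau μ n)
variable {k V W : Type*} [CommRing k] [AddCommGroup V] [Module k V] [AddCommGroup W] [Module k W]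

/-- The column antisymmetrizer of `t`, the signed sum of its column stabilizer, as an operator on
a representation. -/
noncomputable def Tableau.antisymmetrizer (ρ : Representation k (Perm (Fin n)) V) : V →ₗ[k] V :=
  ∑ π ∈ t.colStabilizer, ((Perm.sign π : ℤ) : k) • ρ π

theorem Tableau.antisymmetrizer_apply (ρ : Representation k (Perm (Fin n)) V) (v : V) :
    t.antisymmetrizer ρ v = ∑ π ∈ t.colStabilizer, ((Perm.sign π : ℤ) : k) • ρ π v := by
  simp only [Tableau.antisymmetrizer, LinearMap.sum_apply, LinearMap.smul_apply]

theorem Tableau.map_antisymmetrizer {ρ : Representation k (Perm (Fin n)) V}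
    {σ : Representation k (Perm (Fin n)) W} (φ : Representation.IntertwiningMap ρ σ) (v : V) :
    φ (t.antisymmetrizer ρ v) = t.antisymmetrizer σ (φ v) := by
  simp only [Tableau.antisymmetrizer_apply, map_sum, map_smul, φ.isIntertwining]

theorem Tableau.antisymmetrizer_mem {ρ : Representation k (Perm (Fin n)) V}
    (U : Subrepresentation ρ) {v : V} (hv : v ∈ U.toSubmodule) :
    t.antisymmetrizer ρ v ∈ U.toSubmodule := by
  rw [t.antisymmetrizer_apply]
  exact Submodule.sum_mem _ fun π _ => Submodule.smul_mem _ _ (U.apply_mem_toSubmodule π hv)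

variable {t}

theorem Tableau.antisymmetrizer_apply_of_mem {π : Perm (Fin n)} (hπ : π ∈ t.colStabilizer)
    (ρ : Representation k (Perm (Fin n)) V) (v : V) :
    t.antisymmetrizer ρ (ρ π v) = ((Perm.sign π : ℤ) : k) • t.antisymmetrizer ρ v := by
  rw [t.antisymmetrizer_apply, t.antisymmetrizer_apply, Finset.smul_sum]
  refine Finset.sum_equiv (Equiv.mulRight π) (fun τ => ⟨fun hτ => ?_, fun hτ => ?_⟩) fun τ _ => ?_
  · exact Tableau.mul_mem_colStabilizer hτ hπ
  · simpa using Tableau.mul_mem_colStabilizer hτ (Tableau.inv_mem_colStabilizer hπ)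
  · rw [Equiv.coe_mulRight, smul_smul, ← Int.cast_mul, ← Units.val_mul, Perm.sign_mul, mul_comm,
      mul_assoc, Int.units_mul_self, mul_one, map_mul, Module.End.mul_apply]

variable (t)

theorem Tableau.antisymmetrizer_antisymmetrizer (ρ : Representation k (Perm (Fin n)) V) (v : V) :
    t.antisymmetrizer ρ (t.antisymmetrizer ρ v) =
      (t.colStabilizer.card : k) • t.antisymmetrizer ρ v := by
  have hterm : ∀ π ∈ t.colStabilizer,
      t.antisymmetrizer ρ (((Perm.sign π : ℤ) : k) • ρ π v) = t.antisymmetrizer ρ v := by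
    intro π hπ
    rw [map_smul, Tableau.antisymmetrizer_apply_of_mem hπ, smul_smul, ← Int.cast_mul,
      ← Units.val_mul, Int.units_mul_self, Units.val_one, Int.cast_one, one_smul]
  conv_lhs => rw [t.antisymmetrizer_apply ρ v, map_sum]
  rw [Finset.sum_congr rfl hterm, Finset.sum_const, Nat.cast_smul_eq_nsmul]

theorem Tableau.card_colStabilizer_ne_zero [CharZero k] : (t.colStabilizer.card : k) ≠ 0 :=
  Nat.cast_ne_zero.2 (Finset.card_ne_zero_of_mem Tableau.one_mem_colStabilizer)

theorem Tableau.antisymmetrizer_single_eq_zero {F X : Type*} [Field F] [CharZero F]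
    [MulAction (Perm (Fin n)) X] {word : X → Fin n → ℕ} (hinj : Function.Injective word)
    (hsmul : ∀ (g : Perm (Fin n)) x i, word (g • x) i = word x (g⁻¹ i)) {x : X}
    (hx : ¬ t.ColumnInjective (word x)) :
    t.antisymmetrizer (Representation.ofMulAction F (Perm (Fin n)) X)
      (MonoidAlgebra.single x 1) = 0 := by
  simp only [Tableau.ColumnInjective, not_forall] at hx
  obtain ⟨i, j, hcol, hword, hij⟩ := hx
  have hfix : swap i j • x = x := hinj <| funext fun l => by
    rw [hsmul, swap_inv, apply_swap_eq_self hword]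
  have hneg := Tableau.antisymmetrizer_apply_of_mem (Tableau.swap_mem_colStabilizer hcol)
    (Representation.ofMulAction F (Perm (Fin n)) X) (MonoidAlgebra.single x 1)
  rw [Representation.ofMulAction_single, hfix, Perm.sign_swap hij, Units.val_neg, Units.val_one,
    Int.cast_neg, Int.cast_one, neg_one_smul] at hneg
  rw [← add_eq_zero_iff_eq_neg, ← two_smul F] at hneg
  exact (smul_eq_zero.1 hneg).resolve_left two_ne_zero

theorem Tableau.polytabloid_eq_antisymmetrizer :
    t.polytabloid = t.antisymmetrizer (Representation.ofMulAction ℂ (Perm (Fin n)) (Tabloid μ n))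
      (MonoidAlgebra.single t.tabloid 1) := by
  rw [t.antisymmetrizer_apply, Tableau.polytabloid]
  refine Finset.sum_congr rfl fun π _ => ?_
  rw [Representation.ofMulAction_single, MonoidAlgebra.smul_single, smul_eq_mul, mul_one]

theorem Tableau.antisymmetrizer_polytabloid :
    t.antisymmetrizer (Representation.ofMulAction ℂ (Perm (Fin n)) (Tabloid μ n)) t.polytabloid =
      (t.colStabilizer.card : ℂ) • t.polytabloid := by
  rw [t.polytabloid_eq_antisymmetrizer, t.antisymmetrizer_antisymmetrizer]

end Antisymmetrizer

section Specht

variable {μ : YoungDiagram} {n : ℕ}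

theorem Tabloid.lt_colLen (T : Tabloid μ n) (i : Fin n) : T.1 i < μ.colLen 0 := by
  by_contra h
  have : Nonempty {j // T.1 j = T.1 i} := ⟨⟨i, rfl⟩⟩
  refine (Nat.card_pos (α := {j // T.1 j = T.1 i})).ne' ?_
  rw [T.2, rowLen_eq_zero μ (not_lt.1 h)]

instance : Finite (Tabloid μ n) :=
  Finite.of_injective (β := Fin n → Fin (μ.colLen 0)) (fun T i => ⟨T.1 i, T.lt_colLen i⟩)
    fun _ _ h => Subtype.ext (funext fun i => congrArg Fin.val (congrFun h i))

theorem Tabloid.smul_val_apply (g : Perm (Fin n)) (T : Tabloid μ n) (i : Fin n) :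
    (g • T).1 i = T.1 (g⁻¹ i) := rfl

theorem card_filter_lt_eq_sum (f : Fin n → ℕ) (r : ℕ) :
    (Finset.univ.filter fun i => f i < r).card = ∑ s ∈ Finset.range r, Nat.card {i // f i = s} := by
  rw [Finset.card_eq_sum_card_fiberwise (f := f) (t := Finset.range r)
    fun i hi => by simpa using hi]
  refine Finset.sum_congr rfl fun s hs => ?_
  rw [Nat.card_eq_fintype_card, Fintype.card_subtype, Finset.filter_filter]
  congr 1
  ext i
  simp only [Finset.mem_filter, Finset.mem_univ, true_and, and_iff_right_iff_imp]
  rintro rfl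
  exact Finset.mem_range.1 hs

variable (t : Tableau μ n)

theorem Tableau.card_rowOf_eq (r : ℕ) : Nat.card {i // t.rowOf i = r} = μ.rowLen r :=
  t.tabloid.2 r

theorem Tableau.exists_eq_smul_tabloid {T : Tabloid μ n} (hT : t.ColumnInjective T.1) :
    ∃ π ∈ t.colStabilizer, T = π • t.tabloid := by
  obtain ⟨π, hπ, h⟩ := hT.exists_eq_rowOf fun r => by
    rw [card_filter_lt_eq_sum, card_filter_lt_eq_sum]
    exact (Finset.sum_congr rfl fun s _ => (t.card_rowOf_eq s).trans (T.2 s).symm).le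
  refine ⟨π⁻¹, Tableau.inv_mem_colStabilizer hπ, Subtype.ext (funext fun i => ?_)⟩
  rw [Tabloid.smul_val_apply, inv_inv, h]
  rfl

theorem Tableau.antisymmetrizer_mem_span_polytabloid (v : MonoidAlgebra ℂ (Tabloid μ n)) :
    t.antisymmetrizer (Representation.ofMulAction ℂ (Perm (Fin n)) (Tabloid μ n)) v ∈
      Submodule.span ℂ {t.polytabloid} := by
  induction v using MonoidAlgebra.induction_linear with
  | zero => rw [map_zero]; exact Submodule.zero_mem _
  | add v w hv hw => rw [map_add]; exact Submodule.add_mem _ hv hw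
  | single T a =>
    rw [← mul_one a, ← smul_eq_mul, ← MonoidAlgebra.smul_single, map_smul]
    refine Submodule.smul_mem _ _ ?_
    by_cases hT : t.ColumnInjective T.1
    · obtain ⟨π, hπ, rfl⟩ := t.exists_eq_smul_tabloid hT
      rw [← Representation.ofMulAction_single, Tableau.antisymmetrizer_apply_of_mem hπ,
        ← t.polytabloid_eq_antisymmetrizer]
      exact Submodule.smul_mem _ _ (Submodule.mem_span_singleton_self _)
    · rw [t.antisymmetrizer_single_eq_zero (word := fun T : Tabloid μ n => T.1)
        Subtype.val_injective (fun _ _ _ => rfl) hT]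
      exact Submodule.zero_mem _

theorem Tableau.eq_one_of_smul_tabloid_eq {π : Perm (Fin n)} (hπ : π ∈ t.colStabilizer)
    (h : π • t.tabloid = t.tabloid) : π = 1 := by
  refine Equiv.ext fun i =>
    t.eq_of_rowOf_eq_of_colOf_eq ?_ (Tableau.mem_colStabilizer.1 hπ i)
  have hrow := congrFun (congrArg Subtype.val h) (π i)
  rw [Tabloid.smul_val_apply, Perm.inv_def, Equiv.symm_apply_apply] at hrow
  exact hrow.symm

theorem Tableau.coeff_polytabloid_tabloid : t.polytabloid.coeff t.tabloid = 1 := by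
  classical
  simp only [Tableau.polytabloid, MonoidAlgebra.coeff_sum, MonoidAlgebra.coeff_single,
    Finsupp.finsetSum_apply]
  rw [Finset.sum_eq_single_of_mem 1 Tableau.one_mem_colStabilizer fun π hπ hne =>
    Finsupp.single_eq_of_ne' fun h => hne (t.eq_one_of_smul_tabloid_eq hπ h)]
  simp

theorem Tableau.polytabloid_ne_zero : t.polytabloid ≠ 0 := by
  intro h
  have hcoeff := t.coeff_polytabloid_tabloid
  rw [h] at hcoeff
  exact zero_ne_one hcoeff

theorem Tableau.polytabloid_mem_spechtSubrep : t.polytabloid ∈ (spechtSubrep μ n).toSubmodule :=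
  Submodule.subset_span ⟨t, rfl⟩

theorem Tableau.exists_ofMulAction_polytabloid_eq (t' : Tableau μ n) : ∃ g : Perm (Fin n),
    Representation.ofMulAction ℂ (Perm (Fin n)) (Tabloid μ n) g t.polytabloid =
      t'.polytabloid := by
  refine ⟨t.trans t'.symm, ?_⟩
  rw [ofMulAction_polytabloid]
  congr 1
  ext1 i
  simp [Perm.inv_def]

variable {t}

theorem Tableau.spechtSubrep_le {U : Subrepresentation
    (Representation.ofMulAction ℂ (Perm (Fin n)) (Tabloid μ n))}
    (h : t.polytabloid ∈ U.toSubmodule) : spechtSubrep μ n ≤ U := by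
  refine (Submodule.span_le (p := U.toSubmodule)).2 ?_
  rintro _ ⟨t', rfl⟩
  obtain ⟨g, hg⟩ := t.exists_ofMulAction_polytabloid_eq t'
  rw [← hg]
  exact U.apply_mem_toSubmodule g h

theorem Tableau.antisymmetrizer_eq_zero_of_lt_spechtSubrep {U : Subrepresentation
    (Representation.ofMulAction ℂ (Perm (Fin n)) (Tabloid μ n))} (hU : U < spechtSubrep μ n)
    {u : MonoidAlgebra ℂ (Tabloid μ n)} (hu : u ∈ U.toSubmodule) :
    t.antisymmetrizer (Representation.ofMulAction ℂ (Perm (Fin n)) (Tabloid μ n)) u = 0 := by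
  obtain ⟨a, ha⟩ := Submodule.mem_span_singleton.1 (t.antisymmetrizer_mem_span_polytabloid u)
  rw [← ha]
  rcases eq_or_ne a 0 with rfl | ha0
  · exact zero_smul _ _
  · have hmem := t.antisymmetrizer_mem U hu
    rw [← ha, Submodule.smul_mem_iff _ ha0] at hmem
    exact absurd (Tableau.spechtSubrep_le hmem) hU.not_ge

variable (t)

-- James' submodule argument: the antisymmetrizer kills `U`, so it moves the polytabloid into an
-- invariant complement of `U`, which therefore contains the whole Specht module.
theorem Tableau.isAtom_spechtSubrep (t : Tableau μ n) : IsAtom (spechtSubrep μ n) := by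
  have : NeZero (Nat.card (Perm (Fin n)) : ℂ) := ⟨by exact_mod_cast Nat.card_pos.ne'⟩
  refine ⟨fun h => t.polytabloid_ne_zero ?_, fun U hU => ?_⟩
  · have hmem := t.polytabloid_mem_spechtSubrep
    rw [h] at hmem
    exact (Submodule.mem_bot ℂ).1 hmem
  · obtain ⟨U', hU'⟩ := exists_isCompl U
    have htop : t.polytabloid ∈ (U ⊔ U').toSubmodule := by
      rw [hU'.sup_eq_top]
      exact Submodule.mem_top
    rw [Subrepresentation.toSubmodule_sup] at htop
    obtain ⟨u, hu, u', hu', hsum⟩ := Submodule.mem_sup.1 htop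
    have hmem : t.polytabloid ∈ U'.toSubmodule := by
      rw [← Submodule.smul_mem_iff _ (t.card_colStabilizer_ne_zero (k := ℂ)),
        ← t.antisymmetrizer_polytabloid, ← hsum, map_add,
        Tableau.antisymmetrizer_eq_zero_of_lt_spechtSubrep hU hu, zero_add]
      exact t.antisymmetrizer_mem U' hu'
    exact hU'.disjoint.eq_bot_of_le (hU.le.trans (Tableau.spechtSubrep_le hmem))

theorem Tableau.isIrreducible_spechtRep (t : Tableau μ n) : (spechtRep μ n).IsIrreducible :=
  isIrreducible_toRepresentation_iff_isAtom.2 t.isAtom_spechtSubrep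

/-- The polytabloid of `t` as an element of the Specht module, which it generates. -/
noncomputable def Tableau.spechtVector : (spechtSubrep μ n).toSubmodule :=
  ⟨t.polytabloid, t.polytabloid_mem_spechtSubrep⟩

theorem Tableau.antisymmetrizer_spechtVector :
    t.antisymmetrizer (spechtRep μ n) t.spechtVector =
      (t.colStabilizer.card : ℂ) • t.spechtVector := by
  refine Subtype.ext ?_
  rw [Submodule.coe_smul]
  refine Eq.trans ?_ t.antisymmetrizer_polytabloid
  rw [t.antisymmetrizer_apply, t.antisymmetrizer_apply, AddSubmonoidClass.coe_finsetSum]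
  rfl

section IntertwiningMap

variable {V : Type*} [AddCommGroup V] [Module ℂ V] {σ : Representation ℂ (Perm (Fin n)) V}

theorem Tableau.intertwiningMap_ext {φ ψ : (spechtRep μ n).IntertwiningMap σ}
    (h : φ t.spechtVector = ψ t.spechtVector) : φ = ψ := by
  have := t.isIrreducible_spechtRep
  rw [← sub_eq_zero]
  refine (Representation.IsIrreducible.injective_or_eq_zero (φ - ψ)).resolve_left fun hinj => ?_
  have h0 : t.spechtVector = 0 := hinj <| by
    rw [map_zero, Representation.IntertwiningMap.coe_sub, Pi.sub_apply, h, sub_self]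
  exact t.polytabloid_ne_zero (congrArg Subtype.val h0)

theorem Tableau.map_spechtVector (φ : (spechtRep μ n).IntertwiningMap σ) :
    φ t.spechtVector =
      (t.colStabilizer.card : ℂ)⁻¹ • t.antisymmetrizer σ (φ t.spechtVector) := by
  rw [← t.map_antisymmetrizer, t.antisymmetrizer_spechtVector, map_smul, smul_smul,
    inv_mul_cancel₀ t.card_colStabilizer_ne_zero, one_smul]

theorem Tableau.finrank_intertwiningMap_eq_zero (hσ : t.antisymmetrizer σ = 0) :
    Module.finrank ℂ ((spechtRep μ n).IntertwiningMap σ) = 0 := by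
  have : Subsingleton ((spechtRep μ n).IntertwiningMap σ) := ⟨fun φ ψ => t.intertwiningMap_ext <| by
    rw [t.map_spechtVector φ, t.map_spechtVector ψ, hσ, LinearMap.zero_apply, LinearMap.zero_apply]⟩
  exact Module.finrank_zero_of_subsingleton

end IntertwiningMap

theorem Tableau.antisymmetrizer_ofMulAction_eq_zero {X : Type*} [MulAction (Perm (Fin n)) X]
    {word : X → Fin n → ℕ} (hinj : Function.Injective word)
    (hsmul : ∀ (g : Perm (Fin n)) x i, word (g • x) i = word x (g⁻¹ i))
    (hX : ∀ x, ¬ t.ColumnInjective (word x)) :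
    t.antisymmetrizer (Representation.ofMulAction ℂ (Perm (Fin n)) X) = 0 := by
  refine LinearMap.ext fun v => ?_
  induction v using MonoidAlgebra.induction_linear with
  | zero => exact map_zero _
  | add v w hv hw => rw [map_add, hv, hw, map_add]
  | single x a =>
    rw [← mul_one a, ← smul_eq_mul, ← MonoidAlgebra.smul_single, map_smul,
      t.antisymmetrizer_single_eq_zero hinj hsmul (hX x), smul_zero, LinearMap.zero_apply]

theorem Tableau.finrank_intertwiningMap_tabloid (t : Tableau μ n) :
    Module.finrank ℂ ((spechtRep μ n).IntertwiningMap
      (Representation.ofMulAction ℂ (Perm (Fin n)) (Tabloid μ n))) = 1 := by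
  let ι : (spechtRep μ n).IntertwiningMap
      (Representation.ofMulAction ℂ (Perm (Fin n)) (Tabloid μ n)) :=
    ⟨(spechtSubrep μ n).toSubmodule.subtype, fun _ => rfl⟩
  have hι : ι t.spechtVector = t.polytabloid := rfl
  refine finrank_eq_one ι (fun h => t.polytabloid_ne_zero ?_) fun φ => ?_
  · rw [← hι, h]
    rfl
  · obtain ⟨a, ha⟩ := Submodule.mem_span_singleton.1
      (t.antisymmetrizer_mem_span_polytabloid (φ t.spechtVector))
    refine ⟨(t.colStabilizer.card : ℂ)⁻¹ * a, t.intertwiningMap_ext ?_⟩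
    rw [Representation.IntertwiningMap.smul_apply, hι, t.map_spechtVector φ, ← ha, smul_smul]

end Specht

section ShiftedWords

variable {μ : YoungDiagram} {n N : ℕ}

/-- The words counted by the term of `w` in the expansion of `frobeniusChar l` over the
permutations of the variables. -/
def ShiftedWord (n : ℕ) (l : Fin N → ℕ) (w : Perm (Fin N)) : Type :=
  {f : Fin n → Fin N // ∀ r, content f r + staircase N (w r) = l r}

instance (l : Fin N → ℕ) (w : Perm (Fin N)) : Finite (ShiftedWord n l w) :=
  inferInstanceAs (Finite {f : Fin n → Fin N // ∀ r, content f r + staircase N (w r) = l r})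

instance (l : Fin N → ℕ) (w : Perm (Fin N)) : MulAction (Perm (Fin n)) (ShiftedWord n l w) where
  smul g f := ⟨f.1 ∘ ⇑g⁻¹, fun r => by rw [content_comp_perm]; exact f.2 r⟩
  one_smul _ := rfl
  mul_smul g h f := Subtype.ext <| by
    change f.1 ∘ ⇑(g * h)⁻¹ = (f.1 ∘ ⇑h⁻¹) ∘ ⇑g⁻¹
    rw [mul_inv_rev, Perm.coe_mul, Function.comp_assoc]

theorem card_fixed_shiftedWord (l : Fin N → ℕ) (w : Perm (Fin N)) (g : Perm (Fin n)) :
    Nat.card {f : ShiftedWord n l w // g • f = f} = (Finset.univ.filter fun f : Fin n → Fin N =>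
      f ∘ g = f ∧ ∀ r, content f r + staircase N (w r) = l r).card := by
  have hfix (f : Fin n → Fin N) : f ∘ ⇑g⁻¹ = f ↔ f ∘ g = f :=
    (Equiv.comp_symm_eq g f f).trans eq_comm
  rw [← Fintype.card_subtype, ← Nat.card_eq_fintype_card]
  exact Nat.card_congr
    { toFun := fun f => ⟨f.1.1, (hfix _).1 (congrArg Subtype.val f.2), f.1.2⟩
      invFun := fun f => ⟨⟨f.1, f.2.2⟩, Subtype.ext ((hfix _).2 f.2.1)⟩
      left_inv := fun _ => rfl
      right_inv := fun _ => rfl }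

theorem frobeniusChar_eq_sum_character (l : Fin N →₀ ℕ) (g : Perm (Fin n)) :
    (frobeniusChar l g : ℂ) = ∑ w : Perm (Fin N), ((Perm.sign w : ℤ) : ℂ) *
      (Representation.ofMulAction ℂ (Perm (Fin n)) (ShiftedWord n l w)).character g := by
  rw [frobeniusChar_eq_sum, Int.cast_sum]
  refine Finset.sum_congr rfl fun w _ => ?_
  rw [character_ofMulAction, card_fixed_shiftedWord, Int.cast_mul, Int.cast_natCast]

theorem card_val_eq_content (f : Fin n → Fin N) (r : Fin N) :
    Nat.card {i // (f i : ℕ) = r} = content f r := by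
  rw [content_apply, ← Nat.card_eq_fintype_card]
  exact Nat.card_congr (Equiv.subtypeEquivRight fun i => Fin.ext_iff.symm)

theorem sum_range_eq_sum_fin_lt {r : ℕ} (hr : r ≤ N) (F : ℕ → ℕ) :
    ∑ s ∈ Finset.range r, F s = ∑ i : Fin N with i.1 < r, F i := by
  rw [Finset.sum_filter, Fin.sum_univ_eq_sum_range (fun s => if s < r then F s else 0),
    ← Finset.sum_filter]
  congr 1
  ext s
  rw [Finset.mem_filter, Finset.mem_range, Finset.mem_range]
  exact ⟨fun h => ⟨h.trans_le hr, h⟩, And.right⟩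

theorem sum_lt_comp_perm_le {e : Fin N → ℕ} (he : Antitone e) (w : Perm (Fin N)) (r : ℕ) :
    ∑ i : Fin N with i.1 < r, e (w i) ≤ ∑ i : Fin N with i.1 < r, e i := by
  have hanti : Antitone fun i : Fin N => if (i : ℕ) < r then 1 else 0 := fun i j hij => by
    dsimp only
    split_ifs with hj hi
    · exact le_rfl
    · exact absurd ((Fin.le_def.1 hij).trans_lt hj) hi
    · exact zero_le_one
    · exact le_rfl
  simpa only [smul_eq_mul, ite_mul, one_mul, zero_mul, ← Finset.sum_filter] using
    (hanti.monovary he).sum_smul_comp_perm_le_sum_smul (σ := w)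

theorem Tableau.card_rowOf_lt_le (t : Tableau μ n) {w : Perm (Fin N)}
    (f : ShiftedWord n (shiftedParts μ N) w) (r : ℕ) :
    (Finset.univ.filter fun i => t.rowOf i < r).card ≤
      (Finset.univ.filter fun i => (f.1 i : ℕ) < r).card := by
  rcases le_total r N with hr | hr
  · rw [card_filter_lt_eq_sum, card_filter_lt_eq_sum, sum_range_eq_sum_fin_lt hr,
      sum_range_eq_sum_fin_lt hr]
    simp only [t.card_rowOf_eq, card_val_eq_content]
    have hle := sum_lt_comp_perm_le strictAnti_staircase.antitone w r
    have heq : ∑ i : Fin N with i.1 < r, (content f.1 i + staircase N (w i)) =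
        ∑ i : Fin N with i.1 < r, (μ.rowLen i + staircase N i) :=
      Finset.sum_congr rfl fun i _ => f.2 i
    rw [Finset.sum_add_distrib, Finset.sum_add_distrib] at heq
    omega
  · refine Finset.card_le_card fun i _ => ?_
    exact (Finset.mem_filter_univ i).2 ((f.1 i).2.trans_le hr)

theorem Tableau.eq_one_of_columnInjective (t : Tableau μ n) {w : Perm (Fin N)}
    {f : ShiftedWord n (shiftedParts μ N) w} (hf : t.ColumnInjective fun i => (f.1 i : ℕ)) :
    w = 1 := by
  obtain ⟨π, -, hπ⟩ := hf.exists_eq_rowOf (t.card_rowOf_lt_le f)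
  refine Equiv.ext fun s => strictAnti_staircase.injective ?_
  have hcontent : content f.1 s = μ.rowLen s := by
    rw [← card_val_eq_content, ← t.card_rowOf_eq]
    exact Nat.card_congr (π.subtypeEquiv fun i => by rw [hπ])
  have hshift := f.2 s
  rw [hcontent, shiftedParts_apply] at hshift
  exact Nat.add_left_cancel hshift

theorem ShiftedWord.card_val_eq_rowLen (hN : μ.colLen 0 ≤ N)
    (f : ShiftedWord n (shiftedParts μ N) 1) (r : ℕ) :
    Nat.card {i // (f.1 i : ℕ) = r} = μ.rowLen r := by
  by_cases hr : r < N
  · have hshift := f.2 ⟨r, hr⟩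
    rw [← card_val_eq_content] at hshift
    exact Nat.add_right_cancel hshift
  · rw [rowLen_eq_zero μ (hN.trans (not_lt.1 hr))]
    have : IsEmpty {i // (f.1 i : ℕ) = r} := ⟨fun i => hr (i.2 ▸ (f.1 i.1).2)⟩
    exact Nat.card_of_isEmpty

theorem character_shiftedWord_one (hN : μ.colLen 0 ≤ N) (g : Perm (Fin n)) :
    (Representation.ofMulAction ℂ (Perm (Fin n))
      (ShiftedWord n (shiftedParts μ N) 1)).character g =
    (Representation.ofMulAction ℂ (Perm (Fin n)) (Tabloid μ n)).character g := by
  rw [character_ofMulAction, character_ofMulAction]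
  congr 1
  exact Nat.card_congr
    { toFun := fun f => ⟨⟨fun i => f.1.1 i, f.1.card_val_eq_rowLen hN⟩,
        Subtype.ext (funext fun i => congrArg Fin.val (congrFun (congrArg Subtype.val f.2) i))⟩
      invFun := fun T => ⟨⟨fun i => ⟨T.1.1 i, (T.1.lt_colLen i).trans_le hN⟩, fun r => by
          rw [← card_val_eq_content, shiftedParts_apply, ← T.1.2 r]
          rfl⟩,
        Subtype.ext (funext fun i => Fin.ext (congrFun (congrArg Subtype.val T.2) i))⟩
      left_inv := fun _ => rfl
      right_inv := fun _ => rfl }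

end ShiftedWords

section FrobeniusFormula

variable {μ : YoungDiagram} {n N : ℕ}

theorem sum_character_mul_character_inv_eq_finrank {G V W : Type*} [Group G] [Fintype G]
    [AddCommGroup V] [Module ℂ V] [FiniteDimensional ℂ V] [AddCommGroup W] [Module ℂ W]
    [FiniteDimensional ℂ W] (σ : Representation ℂ G V) (ρ : Representation ℂ G W) :
    ∑ g, σ.character g * ρ.character g⁻¹ =
      Nat.card G * Module.finrank ℂ (ρ.IntertwiningMap σ) := by
  have hG : (Nat.card G : ℂ) ≠ 0 := Nat.cast_ne_zero.2 Nat.card_pos.ne'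
  have := invertibleOfNonzero hG
  exact (inv_mul_eq_iff_eq_mul₀ hG).1
    (Representation.card_inv_mul_sum_char_mul_char_eq_finrank ρ σ)

theorem Tableau.sum_character_shiftedWord_mul (t : Tableau μ n) (hN : μ.colLen 0 ≤ N)
    (w : Perm (Fin N)) :
    ∑ g : Perm (Fin n), (Representation.ofMulAction ℂ (Perm (Fin n))
      (ShiftedWord n (shiftedParts μ N) w)).character g * (spechtRep μ n).character g⁻¹ =
      if w = 1 then (Nat.card (Perm (Fin n)) : ℂ) else 0 := by
  split_ifs with hw
  · subst hw
    simp only [character_shiftedWord_one hN]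
    rw [sum_character_mul_character_inv_eq_finrank, t.finrank_intertwiningMap_tabloid,
      Nat.cast_one, mul_one]
  · rw [sum_character_mul_character_inv_eq_finrank, t.finrank_intertwiningMap_eq_zero,
      Nat.cast_zero, mul_zero]
    exact t.antisymmetrizer_ofMulAction_eq_zero
      (word := fun (f : ShiftedWord n (shiftedParts μ N) w) i => (f.1 i : ℕ))
      (fun f f' h => Subtype.ext (funext fun i => Fin.ext (congrFun h i))) (fun _ _ _ => rfl)
      fun f hf => hw (t.eq_one_of_columnInjective hf)

theorem Tableau.sum_frobeniusChar_mul_character (t : Tableau μ n) (hN : μ.colLen 0 ≤ N) :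
    ∑ g : Perm (Fin n), (frobeniusChar (shiftedParts μ N) g : ℂ) *
      (spechtRep μ n).character g⁻¹ = Nat.card (Perm (Fin n)) := by
  simp only [frobeniusChar_eq_sum_character, Finset.sum_mul]
  rw [Finset.sum_comm]
  simp only [mul_assoc, ← Finset.mul_sum, t.sum_character_shiftedWord_mul hN, mul_ite, mul_zero,
    Finset.sum_ite_eq', Finset.mem_univ, if_true, Perm.sign_one, Units.val_one, Int.cast_one,
    one_mul]

open Matrix in
theorem eq_of_star_dotProduct_eq {ι R : Type*} [Fintype ι] [NonUnitalCommRing R] [PartialOrder R]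
    [StarRing R] [StarOrderedRing R] [NoZeroDivisors R] {v w : ι → R}
    (hv : star v ⬝ᵥ v = star v ⬝ᵥ w) (hw : star w ⬝ᵥ w = star v ⬝ᵥ w) : v = w := by
  have hwv : star w ⬝ᵥ v = star w ⬝ᵥ w := by
    rw [star_dotProduct, ← hw, ← star_dotProduct]
  rw [← sub_eq_zero, ← dotProduct_star_self_eq_zero, star_sub, sub_dotProduct, dotProduct_sub,
    dotProduct_sub, hv, hwv, sub_self, sub_self, sub_zero]

open Matrix in
open scoped ComplexOrder in
theorem Tableau.character_spechtRep (t : Tableau μ n) (hN : μ.colLen 0 ≤ N) (g : Perm (Fin n)) :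
    (spechtRep μ n).character g = frobeniusChar (shiftedParts μ N) g := by
  classical
  set χ := (spechtRep μ n).character
  set φ : Perm (Fin n) → ℂ := fun g => frobeniusChar (shiftedParts μ N) g
  have hχφ : star χ ⬝ᵥ φ = Nat.card (Perm (Fin n)) := by
    rw [← t.sum_frobeniusChar_mul_character hN]
    refine Finset.sum_congr rfl fun g _ => ?_
    rw [character_inv_eq_conj, mul_comm]
    rfl
  have hχχ : star χ ⬝ᵥ χ = Nat.card (Perm (Fin n)) := by
    have := t.isIrreducible_spechtRep
    have hsum := sum_character_mul_character_inv (spechtRep μ n) (spechtRep μ n)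
    rw [if_pos ⟨Representation.Equiv.refl _⟩, mul_one] at hsum
    rw [← hsum]
    refine Finset.sum_congr rfl fun g _ => ?_
    rw [character_inv_eq_conj, mul_comm]
    rfl
  have hφφ : star φ ⬝ᵥ φ = Nat.card (Perm (Fin n)) := by
    have hsq := sum_frobeniusChar_sq (ι := Fin n) (l := shiftedParts μ N)
      (by rw [sum_shiftedParts μ hN, t.card_eq, Fintype.card_fin])
      (strictAnti_shiftedParts μ).injective
    rw [Nat.card_eq_fintype_card, Fintype.card_perm, ← Int.cast_natCast, ← hsq, Int.cast_sum]
    refine Finset.sum_congr rfl fun g _ => ?_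
    rw [Pi.star_apply, star_intCast, Int.cast_pow, sq]
  exact congrFun (eq_of_star_dotProduct_eq (hχχ.trans hχφ.symm) (hφφ.trans hχφ.symm)) g

end FrobeniusFormula

section HilbertSeries

variable {n : ℕ}

open PowerSeries

theorem coeff_fixedWordSum_X_pow {N d : ℕ} (hd : d < N) (g : Perm (Fin n)) :
    coeff d (fixedWordSum g fun j : Fin N => (X : ℂ⟦X⟧) ^ (j : ℕ)) =
      (homogeneousRep n d).character g := by
  rw [character_homogeneousRep, fixedWordSum, map_sum]
  simp only [Finset.prod_pow_eq_pow_sum, coeff_X_pow]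
  rw [Finset.sum_boole, Finset.filter_filter, ← Fintype.card_subtype, ← Nat.card_eq_fintype_card]
  congr 1
  refine Nat.card_congr
    { toFun := fun f =>
        ⟨fun i => f.1 i, f.2.2.symm, funext fun i => congrArg Fin.val (congrFun f.2.1 i)⟩
      invFun := fun a => ⟨fun i => ⟨a.1 i, lt_of_le_of_lt ?_ hd⟩,
        funext fun i => Fin.ext (congrFun a.2.2 i), a.2.1.symm⟩
      left_inv := fun _ => rfl
      right_inv := fun _ => rfl }
  exact (Finset.single_le_sum (fun _ _ => Nat.zero_le _) (Finset.mem_univ i)).trans_eq a.2.1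

theorem sum_character_homogeneousRep_mul {μ : YoungDiagram} (d : ℕ) (box : Fin n ≃ μ.cells) :
    ∑ g : Perm (Fin n), (homogeneousRep n d).character g * (spechtRep μ n).character g⁻¹ =
      Nat.card (Perm (Fin n)) * Set.ncard {y : Fin n → ℕ |
        ∑ i, (hookLength μ (box i) : ℤ) * (y i : ℤ) = (d : ℤ) - (nStat μ : ℤ)} := by
  obtain ⟨N, hN⟩ : ∃ N, N = μ.colLen 0 + d + 1 := ⟨_, rfl⟩
  have hseries := alternant_mul_sum_frobeniusChar (ι := Fin n) (l := shiftedParts μ N)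
    (by rw [sum_shiftedParts μ (by omega), Tableau.card_eq box, Fintype.card_fin])
    ((X_pow_injective (R := ℂ)).comp (Fin.val_injective (n := N)))
  rw [← Fintype.card_perm, ← Nat.card_eq_fintype_card, ← map_natCast (C (R := ℂ))] at hseries
  rw [← coeff_eq_mul_ncard_of_alternant_mul_eq (d := d) (by omega) box hseries, map_sum]
  refine Finset.sum_congr rfl fun g _ => ?_
  have hcoeff := coeff_fixedWordSum_X_pow (N := N) (d := d) (by omega) g
  rw [← map_intCast (C (R := ℂ)), coeff_C_mul, Function.comp_def, hcoeff, character_inv_eq_conj,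
    Tableau.character_spechtRep (N := N) box (by omega), map_intCast, mul_comm]

end HilbertSeries

end SymMult

/-- `box` is any numbering of the boxes of `μ`, so that `hookLength μ (box i)` is the hook length of
the `i`-th box. -/
theorem mainTheorem1 (n d : ℕ) (μ : YoungDiagram) (hμ : μ.card = n) (box : Fin n ≃ μ.cells) :
    (SymMult.spechtRep μ n).IsIrreducible ∧
    SymMult.HasMultiplicity (SymMult.homogeneousRep n d) (SymMult.spechtRep μ n)
      (Set.ncard {y : Fin n → ℕ |
        ∑ i, (SymMult.hookLength μ (box i) : ℤ) * (y i : ℤ) = (d : ℤ) - (SymMult.nStat μ : ℤ)}) := by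
  have hirr := SymMult.Tableau.isIrreducible_spechtRep box
  exact ⟨hirr, SymMult.hasMultiplicity_of_sum_character_mul
    (SymMult.sum_character_homogeneousRep_mul d box)⟩
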